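/- Let $K$ be a field of characteristic $0$. Let $\mathrm{B}(1)$ be the Buttin superalgebra over $K$: its elements are the generating functions $f=f_0(x)+f_1(x)X$ with $x$ an even variable, $X$ an odd variable ($X^2=0$) and $f_0,f_1\in K[[x]]$ formal power series, with bracket $$\{f,g\}=\frac{\partial f}{\partial x}\frac{\partial g}{\partial X}+(-1)^{p(f)}\frac{\partial f}{\partial X}\frac{\partial g}{\partial x},$$ where $p(f)$ is the parity of the generating function $f$. As elements of the Lie superalgebra the $x^iX$ are even and the $x^i$ are odd. Let $C^k$ be the space of continuous super skew-symmetric $k$-linear forms on $\mathrm{B}(1)$ with values in the trivial module $K$ (continuous: depending only on the Taylor coefficients of the arguments up to some finite order), where super skew-symmetry means symmetry under transpositions of adjacent odd arguments and antisymmetry under all other transpositions of adjacent arguments. The differential is given on homogeneous arguments by $$dC(a_0,\ldots,a_k)=\sum_{i<j}(-1)^{j+p(a_j)(p(a_{i+1})+\cdots+p(a_{j-1}))}\,C(a_0,\ldots,a_{i-1},\{a_i,a_j\},a_{i+1},\ldots,\widehat{a_j},\ldots,a_k),$$ where now $p$ denotes the parity in the Lie superalgebra, and $H^k(\mathrm{B}(1))=Z^k/B^k$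 is the quotient of the $k$-cocycles by the $k$-coboundaries. For basis monomials $u_1,\ldots,u_k$ (each of the form $x^iX$ or $x^i$) write $C(u_1,\ldots,u_k)=C(u_1)\wedge\cdots\wedge C(u_k)$ for the exterior product of the 1-cochains $C(u_i)$ dual to the monomials $u_i$. Put $$a^3=C(X,xX,x^2X),\qquad b^3=C(X,xX,x)-\tfrac12\,C(X,x^2X,1).$$ Then: 1. The element $1$ is an odd central element of $\mathrm{B}(1)$. 2. $H^0(\mathrm{B}(1))$ is one-dimensional, spanned by the class of the 0-cochain $1$, and $H^1(\mathrm{B}(1))=H^2(\mathrm{B}(1))=0$. 3. For every $m\ge 0$ the cochains $a^3\wedge C(1)^{\wedge m}$ and $b^3\wedge C(1)^{\wedge m}$ are cocycles of degree $m+3$, and their classes form a basis of $H^{m+3}(\mathrm{B}(1))$. In particular $H^3(\mathrm{B}(1))$ has the basis $a^3,b^3$, and $a^3$, $b^3$ together with their exterior products with powers of $C(1)$ account for all cohomology of positive degree. -/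

import Mathlib

/-! The Buttin superalgebra `B(1)` of formal vector fields and its continuous cochain complex
with trivial coefficients. -/

namespace Buttin

/-- Generating functions `f(x, X) = f₀(x) + f₁(x) X` with `x` an even and `X` an odd variable
(`X * X = 0`), the coefficients `f₀ = f.fst` and `f₁ = f.snd` being formal power series in `x`. -/
abbrev B1 (K : Type*) [Field K] : Type _ := DualNumber (PowerSeries K)

section
variable {K : Type*} [Field K]

/-- `∂f/∂x`. -/
noncomputable def dx (f : B1 K) : B1 K :=
  TrivSqZeroExt.inl (PowerSeries.derivative K f.fst) +
    TrivSqZeroExt.inr (PowerSeries.derivative K f.snd)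

/-- `∂f/∂X`. -/
noncomputable def dX (f : B1 K) : B1 K := TrivSqZeroExt.inl f.snd

/-- `(-1)^{p(f)} f`, where `p` is the parity of generating functions: `p(x) = 0`, `p(X) = 1`. -/
noncomputable def grassmannSign (f : B1 K) : B1 K :=
  TrivSqZeroExt.inl f.fst - TrivSqZeroExt.inr f.snd

/-- The Buttin bracket `∂f/∂x ∂g/∂X + (-1)^{p(f)} ∂f/∂X ∂g/∂x`. -/
noncomputable def bracket (f g : B1 K) : B1 K := dx f * dX g + dX (grassmannSign f) * dx g

/-- The even part of an element of the Lie superalgebra. The parity of the Lie superalgebra is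
opposite to that of generating functions: `x^i X` is even, `x^i` is odd. -/
noncomputable def evenPart (f : B1 K) : B1 K := TrivSqZeroExt.inr f.snd

/-- The odd part of an element of the Lie superalgebra. -/
noncomputable def oddPart (f : B1 K) : B1 K := TrivSqZeroExt.inl f.fst

def IsEven (f : B1 K) : Prop := f.fst = 0

def IsOdd (f : B1 K) : Prop := f.snd = 0

/-- `f ↦ (-1)^{p(f)} f` for the parity of the Lie superalgebra. -/
noncomputable def superSign (f : B1 K) : B1 K := evenPart f - oddPart f

/-- Apply `superSign` to the arguments whose position satisfies `P`. This is the sign produced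
when an odd element is moved past these arguments. -/
noncomputable def twist {k : ℕ} (P : Fin k → Prop) [DecidablePred P] (a : Fin k → B1 K) :
    Fin k → B1 K :=
  fun l => if P l then superSign (a l) else a l

/-- Super skew-symmetry: symmetry under transposition of two adjacent odd arguments,
antisymmetry under all other transpositions of adjacent arguments. -/
def IsSuperSkew {k : ℕ} (C : (Fin k → B1 K) → K) : Prop :=
  ∀ (a : Fin k → B1 K) (i j : Fin k), (i : ℕ) + 1 = j →
    (IsOdd (a i) → IsOdd (a j) → C (a ∘ Equiv.swap i j) = C a) ∧
    (IsEven (a i) ∨ IsEven (a j) → C (a ∘ Equiv.swap i j) = - C a)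

/-- Continuity for the formal power series topology and the discrete topology on `K`: a
multilinear form is continuous if and only if it only depends on the Taylor polynomials of its
arguments up to some fixed order. -/
def IsFiniteOrder {k : ℕ} (C : (Fin k → B1 K) → K) : Prop :=
  ∃ N : ℕ, ∀ a b : Fin k → B1 K,
    (∀ i, ∀ n < N, PowerSeries.coeff n (a i).fst = PowerSeries.coeff n (b i).fst ∧
      PowerSeries.coeff n (a i).snd = PowerSeries.coeff n (b i).snd) → C a = C b

end

section
variable (K : Type*) [Field K]

/-- `C^k(B(1); K)`: continuous super skew-symmetric `k`-linear forms on `B(1)`. -/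
def cochains (k : ℕ) : Submodule K ((Fin k → B1 K) → K) where
  carrier := {C | (∃ M : MultilinearMap K (fun _ : Fin k => B1 K) K, ∀ a, M a = C a) ∧
    IsSuperSkew C ∧ IsFiniteOrder C}
  zero_mem' := ⟨⟨0, fun _ => rfl⟩, fun _ _ _ _ => by simp, 0, fun _ _ _ => rfl⟩
  add_mem' := by
    rintro C D ⟨⟨M, hM⟩, hC, N, hN⟩ ⟨⟨M', hM'⟩, hD, N', hN'⟩
    refine ⟨⟨M + M', fun a => by simp [hM, hM']⟩, fun a i j hij => ⟨fun h h' => ?_, fun h => ?_⟩,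
      max N N', fun a b hab => ?_⟩
    · simp [(hC a i j hij).1 h h', (hD a i j hij).1 h h']
    · simp only [Pi.add_apply, (hC a i j hij).2 h, (hD a i j hij).2 h]
      ring
    · simp only [Pi.add_apply]
      rw [hN a b fun i n hn => hab i n (lt_max_of_lt_left hn),
        hN' a b fun i n hn => hab i n (lt_max_of_lt_right hn)]
  smul_mem' := by
    rintro c C ⟨⟨M, hM⟩, hC, N, hN⟩
    refine ⟨⟨c • M, fun a => by simp [hM]⟩, fun a i j hij => ⟨fun h h' => ?_, fun h => ?_⟩,
      N, fun a b hab => ?_⟩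
    · simp [(hC a i j hij).1 h h']
    · simp [(hC a i j hij).2 h]
    · simp [hN a b hab]

/-- The differential of the cochain complex with trivial coefficients. On homogeneous arguments,
`dC(a_0,…,a_k) = ∑_{i<j} (-1)^{j + p(a_j) (p(a_{i+1}) + ⋯ + p(a_{j-1}))}
  C(a_0,…,a_{i-1},[a_i,a_j],a_{i+1},…,a_j omitted,…,a_k)`;
the two summands below are the contributions of the even and the odd part of `a_j`. -/
noncomputable def differential (k : ℕ) :
    ((Fin k → B1 K) → K) →ₗ[K] ((Fin (k + 1) → B1 K) → K) where
  toFun C := fun a => ∑ j : Fin (k + 1), ∑ i ∈ Finset.univ.filter (fun i => i < j),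
    (-1) ^ (j : ℕ) *
      (C (j.removeNth (Function.update a i (bracket (a i) (evenPart (a j))))) +
        C (j.removeNth (Function.update (twist (fun l => i < l ∧ l < j) a) i
          (bracket (a i) (oddPart (a j))))))
  map_add' C D := by
    funext a
    simp only [Pi.add_apply, ← Finset.sum_add_distrib]
    refine Finset.sum_congr rfl fun j _ => Finset.sum_congr rfl fun i _ => ?_
    ring
  map_smul' c C := by
    funext a
    simp only [Pi.smul_apply, smul_eq_mul, RingHom.id_apply, Finset.mul_sum]
    refine Finset.sum_congr rfl fun j _ => Finset.sum_congr rfl fun i _ => ?_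
    ring

/-- `Z^k`. -/
noncomputable def cocycles (k : ℕ) : Submodule K ((Fin k → B1 K) → K) :=
  cochains K k ⊓ LinearMap.ker (differential K k)

/-- `B^k`. -/
noncomputable def coboundaries : (k : ℕ) → Submodule K ((Fin k → B1 K) → K)
  | 0 => ⊥
  | k + 1 => (cochains K k).map (differential K k)

/-- `H^k(B(1)) = Z^k / B^k`. -/
abbrev Cohomology (k : ℕ) : Type _ :=
  cocycles K k ⧸ (coboundaries K k).submoduleOf (cocycles K k)

/-- The cohomology class of a cocycle. -/
noncomputable def cohomologyClass {k : ℕ} (C : (Fin k → B1 K) → K) (hC : C ∈ cocycles K k) :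
    Cohomology K k :=
  Submodule.Quotient.mk ⟨C, hC⟩

/-- `C(x^i X)`: the 1-cochain dual to the basis element `x^i X`. -/
noncomputable def cE (i : ℕ) (f : B1 K) : K := PowerSeries.coeff i f.snd

/-- `C(x^i)`: the 1-cochain dual to the basis element `x^i`. -/
noncomputable def cO (i : ℕ) (f : B1 K) : K := PowerSeries.coeff i f.fst

end

section
variable {K : Type*} [Field K]

/-- The exterior product `C ∧ φ` of a `k`-cochain and a 1-cochain. On homogeneous arguments,
`(C ∧ φ)(a_0,…,a_k) = ∑_j (-1)^{k - j + p(a_j) (p(a_{j+1}) + ⋯ + p(a_k))}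
  C(a_0,…,a_j omitted,…,a_k) φ(a_j)`. -/
noncomputable def wedge {k : ℕ} (C : (Fin k → B1 K) → K) (φ : B1 K → K) :
    (Fin (k + 1) → B1 K) → K :=
  fun a => ∑ j : Fin (k + 1), (-1) ^ (k - (j : ℕ)) *
    (C (j.removeNth a) * φ (evenPart (a j)) +
      C (j.removeNth (twist (fun l => j < l) a)) * φ (oddPart (a j)))

/-- The 0-cochain `1`. -/
def unitCochain : (Fin 0 → B1 K) → K := fun _ => 1

/-- `φ ∧ ψ ∧ χ` for 1-cochains. -/
noncomputable def wedge₃ (φ ψ χ : B1 K → K) : (Fin 3 → B1 K) → K :=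
  wedge (wedge (wedge unitCochain φ) ψ) χ

/-- `C ∧ φ ∧ ⋯ ∧ φ` with `m` factors `φ`. -/
noncomputable def wedgePow {k : ℕ} (C : (Fin k → B1 K) → K) (φ : B1 K → K) :
    (m : ℕ) → (Fin (k + m) → B1 K) → K
  | 0 => C
  | m + 1 => wedge (wedgePow C φ m) φ

end

section
variable (K : Type*) [Field K]

/-- `a³ = C(X, xX, x²X)`. -/
noncomputable def a3 : (Fin 3 → B1 K) → K := wedge₃ (cE K 0) (cE K 1) (cE K 2)

/-- `b³ = C(X, xX, x) - ½ C(X, x²X, 1)`. -/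
noncomputable def b3 : (Fin 3 → B1 K) → K :=
  wedge₃ (cE K 0) (cE K 1) (cO K 1) - (1 / 2 : K) • wedge₃ (cE K 0) (cE K 2) (cO K 0)

end

end Buttin

/-! Everything is tested on monomials. A continuous multilinear form is determined by its values on
lists of monomials, and these values vanish as soon as one entry has large degree. Conversely every
skew function of lists with this finiteness comes from a cochain (`forms_ext`, `exists_cochain`).
Under this dictionary the differential becomes the recursive operator `listDiff`
(`evalList_differential`), and wedging with a 1-cochain becomes `listWedge` (`evalList_wedge`).

Write `E i` for `x^i X`, `O i` for `x^i`, and `1^n` for a block of `n` copies of `O 0`. The element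
`E 1` acts on a list as multiplication by its weight (`listLie_euler`). By Cartan's formula, a
cocycle contracted with `E 1` has as its differential the weight times the cocycle, so all
cohomology sits in weight zero.

The only negative weight is that of `E 0`, namely -1, and an even monomial cannot be repeated. A
weight-zero skew function `c` is therefore determined by its values on six families: `1^n`, `E 1
1^n`, `E 0 E 2 1^n`, `E 0 O 1 1^n`, `E 0 E 1 E 2 1^n`, `E 0 E 1 O 1 1^n`
(`ListSkew.eq_zero_of_canonical`). There the only nonzero values of the differential are `dc(E 0 E 2
1^n) = 2 c(E 1 1^n)`, `dc(E 0 O 1 1^n) = c(1^(n+1))`, `dc(E 0 E 1 O 1 1^n) = c(E 1 1^(n+1))`. So `c`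
is a cocycle iff `c(1^(n+1))` and `c(E 1 1^n)` vanish. A cocycle of positive degree is a coboundary
iff moreover `c(E 0 E 1 E 2 1^n) = 0` and `2 c(E 0 E 1 O 1 1^n) = c(E 0 E 2 1^(n+1))`, which is
`ClassVanishes` (`mem_coboundaries_iff`).

These are two functionals in each degree `n + 3` and none in degrees 1 and 2. On the two proposed
classes of degree `m + 3` they form a diagonal matrix with entries `m!` and `m! (m + 5) / 2`, both
nonzero in characteristic 0 (`classVanishes_sub_iff`). -/

namespace Buttin

/-- Indices of the monomial basis: `E i` stands for `x^i X` and `O i` for `x^i`. -/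
inductive Gen : Type
  | E (i : ℕ) : Gen
  | O (i : ℕ) : Gen

namespace Gen

/-- The weight of a monomial, that is minus the eigenvalue of the bracket with `x X`. -/
def weight : Gen → ℤ
  | E i => (i : ℤ) - 1
  | O i => i

def index : Gen → ℕ
  | E i => i
  | O i => i

/-- The monomial occurring in the bracket of two monomials. -/
def br : Gen → Gen → Gen
  | E i, E j => E (i + j - 1)
  | E i, O j => O (i + j - 1)
  | O i, E j => O (i + j - 1)
  | O _, O _ => O 0

end Gen

open Gen

/-! ### Skew functions of lists of monomials and their differential -/

section ListModel
variable {K : Type*} [Field K]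

/-- The sign `(-1)^{p(x) p(y)}`. -/
def koszul : Gen → Gen → K
  | O _, O _ => -1
  | _, _ => 1

/-- The coefficient of the bracket of two monomials. -/
def brCoeff : Gen → Gen → K
  | E i, E j => i - j
  | E _, O j => -j
  | O i, E _ => i
  | O _, O _ => 0

theorem koszul_comm (x y : Gen) : (koszul x y : K) = koszul y x := by
  cases x <;> cases y <;> rfl

theorem koszul_mul_self (x y : Gen) : (koszul x y * koszul x y : K) = 1 := by
  cases x <;> cases y <;> simp [koszul]

/-- Parity is additive under the bracket. The factor `brCoeff x y` is needed because `br` of two odd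
monomials is a placeholder of the wrong parity, with coefficient 0. -/
theorem brCoeff_mul_koszul (x y z : Gen) :
    (brCoeff x y * koszul (br x y) z : K) = brCoeff x y * (koszul x z * koszul y z) := by
  cases x <;> cases y <;> cases z <;> simp [koszul, brCoeff, br]

theorem brCoeff_mul_swap (x y : Gen) (f : Gen → K) :
    brCoeff y x * f (br y x) = -koszul x y * (brCoeff x y * f (br x y)) := by
  cases x <;> cases y <;> simp [koszul, brCoeff, br, add_comm]
  ring

/-- The exponent `i + j - 1` is truncated only for `i = j = 0`, and then the coefficient is 0. -/
theorem weight_br {x y : Gen} (h : (brCoeff x y : K) ≠ 0) :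
    (br x y).weight = x.weight + y.weight := by
  rcases x with i | i <;> rcases y with j | j <;> simp only [br, weight, brCoeff] at h ⊢
  · have : i + j ≠ 0 := fun h0 => h (by
      obtain ⟨rfl, rfl⟩ : i = 0 ∧ j = 0 := by omega
      simp)
    omega
  · have : j ≠ 0 := fun h0 => h (by simp [h0])
    omega
  · have : i ≠ 0 := fun h0 => h (by simp [h0])
    omega
  · simp at h

/-- The weight of a list of monomials. -/
def listWeight (l : List Gen) : ℤ := (l.map weight).sum

@[simp] theorem listWeight_nil : listWeight [] = 0 := rfl

@[simp] theorem listWeight_cons (x : Gen) (l : List Gen) :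
    listWeight (x :: l) = x.weight + listWeight l := by simp [listWeight]

/-- Super skew-symmetry of a function of lists of monomials. -/
def ListSkew (c : List Gen → K) : Prop :=
  ∀ (l : List Gen) (x y : Gen) (r : List Gen),
    c (l ++ x :: y :: r) = -koszul x y * c (l ++ y :: x :: r)

theorem ListSkew.curry {c : List Gen → K} (hc : ListSkew c) (x : Gen) :
    ListSkew (fun l => c (x :: l)) := fun l y z r => hc (x :: l) y z r

theorem ListSkew.head {c : List Gen → K} (hc : ListSkew c) (x y : Gen) (r : List Gen) :
    c (x :: y :: r) = -koszul x y * c (y :: x :: r) := hc [] x y r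

theorem ListSkew.add {c d : List Gen → K} (hc : ListSkew c) (hd : ListSkew d) :
    ListSkew (fun l => c l + d l) := fun l x y r => by
  simp only [hc l x y r, hd l x y r]; ring

theorem ListSkew.smul {c : List Gen → K} (hc : ListSkew c) (t : K) :
    ListSkew (fun l => t * c l) := fun l x y r => by
  simp only [hc l x y r]; ring

theorem listWeight_swap (l : List Gen) (x y : Gen) (r : List Gen) :
    listWeight (l ++ x :: y :: r) = listWeight (l ++ y :: x :: r) := by
  simp [listWeight]; ring

theorem ListSkew.weight_mul {c : List Gen → K} (hc : ListSkew c) (f : ℤ → K) :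
    ListSkew (fun l => f (listWeight l) * c l) := fun l x y r => by
  simp only [hc l x y r, listWeight_swap l x y r]; ring

/-- The sign is left undetermined, since permutations serve only to transport vanishing. -/
theorem ListSkew.perm {c : List Gen → K} (hc : ListSkew c) {l l' : List Gen} (h : l.Perm l') :
    c l = c l' ∨ c l = -c l' := by
  induction h generalizing c with
  | nil => exact Or.inl rfl
  | cons x _ ih => exact ih (hc.curry x)
  | swap x y r =>
    rw [hc.head]
    cases x <;> cases y <;> simp [koszul]
  | trans _ _ ih1 ih2 =>
    rcases ih1 hc with h1 | h1 <;> rcases ih2 hc with h2 | h2 <;> simp [h1, h2]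

theorem ListSkew.perm_eq_zero {c : List Gen → K} (hc : ListSkew c) {l l' : List Gen}
    (h : l.Perm l') (h0 : c l' = 0) : c l = 0 := by
  rcases hc.perm h with h | h <;> simp [h, h0]

theorem ListSkew.repeat_eq_zero [CharZero K] {c : List Gen → K} (hc : ListSkew c) (i : ℕ)
    (r : List Gen) : c (E i :: E i :: r) = 0 := by
  have := hc.head (E i) (E i) r
  simp only [koszul, neg_mul, one_mul] at this
  exact self_eq_neg.mp this

/-- The action of a monomial on functions of lists, up to sign. -/
def listLie (x : Gen) : List Gen → (List Gen → K) → K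
  | [], _ => 0
  | y :: r, c => -(brCoeff x y * c (br x y :: r)) +
      koszul x y * listLie x r (fun t => c (y :: t))

/-- The differential in terms of lists of monomials. -/
def listDiff : List Gen → (List Gen → K) → K
  | [], _ => 0
  | x :: l, c => listLie x l c - listDiff l (fun t => c (x :: t))

/-- The sign of moving `x` past all entries of a list. -/
def passSign (x : Gen) : List Gen → K
  | [] => 1
  | y :: r => -koszul x y * passSign x r

/-- The exterior product with a 1-cochain in terms of lists of monomials. -/
def listWedge (φ : Gen → K) : List Gen → (List Gen → K) → K
  | [], _ => 0
  | x :: l, c => listWedge φ l (fun t => c (x :: t)) + φ x * passSign x l * c l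

/-- Besides skewness of `c`, this uses that the sign of a bracket is the product of the signs of its
factors (`brCoeff_mul_koszul`). -/
theorem ListSkew.listLie {c : List Gen → K} (hc : ListSkew c) (x : Gen) :
    ListSkew (fun l => listLie x l c) := by
  intro l y z r
  induction l generalizing c with
  | nil =>
    simp only [List.nil_append, Buttin.listLie]
    have e1 : (fun t => c (y :: z :: t)) = fun t => -koszul y z * c (z :: y :: t) :=
      funext fun t => hc.head y z t
    have e2 : ∀ (t : K) (d : List Gen → K) (r : List Gen),
        Buttin.listLie x r (fun u => t * d u) = t * Buttin.listLie x r d := by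
      intro t d r
      induction r generalizing d with
      | nil => simp [Buttin.listLie]
      | cons w r ih => simp only [Buttin.listLie, ih]; ring
    rw [e1, e2, hc.head (br x y) z, hc.head y (br x z), koszul_comm y (br x z)]
    have h1 := brCoeff_mul_koszul (K := K) x y z
    have h2 := brCoeff_mul_koszul (K := K) x z y
    have h3 := koszul_mul_self (K := K) x y
    have h4 := koszul_mul_self (K := K) x z
    have h5 := koszul_mul_self (K := K) y z
    have h6 := koszul_comm (K := K) z y
    rw [h6] at h2
    linear_combination (c (z :: br x y :: r)) * h1 + (koszul x y * c (br x z :: y :: r)) * h2 +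
      (koszul y z * brCoeff x z * c (br x z :: y :: r)) * h3
  | cons w l ih =>
    simp only [List.cons_append, Buttin.listLie]
    have h1 := ih (hc.curry w)
    have h2 := hc (br x w :: l) y z r
    simp only [List.cons_append] at h1 h2
    rw [h1, h2]; ring

theorem listLie_linear (x : Gen) (s t : K) (c d : List Gen → K) (l : List Gen) :
    listLie x l (fun u => s * c u + t * d u) = s * listLie x l c + t * listLie x l d := by
  induction l generalizing c d with
  | nil => simp [listLie]
  | cons w r ih => simp only [listLie, ih]; ring

theorem listDiff_linear (s t : K) (c d : List Gen → K) (l : List Gen) :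
    listDiff l (fun u => s * c u + t * d u) = s * listDiff l c + t * listDiff l d := by
  induction l generalizing c d with
  | nil => simp [listDiff]
  | cons w r ih => simp only [listDiff, ih, listLie_linear]; ring

theorem listDiff_smul (t : K) (c : List Gen → K) (l : List Gen) :
    listDiff l (fun u => t * c u) = t * listDiff l c := by
  simpa using listDiff_linear t 0 c c l

theorem listWedge_smul (φ : Gen → K) (t : K) (c : List Gen → K) (l : List Gen) :
    listWedge φ l (fun u => t * c u) = t * listWedge φ l c := by
  induction l generalizing c with
  | nil => simp [listWedge]
  | cons w r ih => simp only [listWedge, ih]; ring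

theorem ListSkew.listDiff {c : List Gen → K} (hc : ListSkew c) :
    ListSkew (fun l => listDiff l c) := by
  intro l x y r
  induction l generalizing c with
  | nil =>
    simp only [List.nil_append, Buttin.listDiff, Buttin.listLie]
    have e1 : (fun t => c (x :: y :: t)) = fun t => -koszul x y * c (y :: x :: t) :=
      funext fun t => hc.head x y t
    rw [e1, listDiff_smul, brCoeff_mul_swap x y (fun z => c (z :: r)), koszul_comm y x]
    have h := koszul_mul_self (K := K) x y
    linear_combination (brCoeff x y * c (br x y :: r) + Buttin.listLie y r (fun t => c (x :: t))) * h
  | cons w l ih =>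
    simp only [List.cons_append, Buttin.listDiff]
    have h1 := ih (hc.curry w)
    have h2 := (hc.listLie w) l x y r
    simp only at h1 h2
    rw [h1, h2]; ring

theorem passSign_swap (z : Gen) (l : List Gen) (x y : Gen) (r : List Gen) :
    (passSign z (l ++ x :: y :: r) : K) = passSign z (l ++ y :: x :: r) := by
  induction l with
  | nil => simp only [List.nil_append, passSign]; ring
  | cons w l ih => simp only [List.cons_append, passSign, ih]

theorem ListSkew.listWedge {c : List Gen → K} (hc : ListSkew c) (φ : Gen → K) :
    ListSkew (fun l => listWedge φ l c) := by
  intro l x y r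
  induction l generalizing c with
  | nil =>
    simp only [List.nil_append, Buttin.listWedge, passSign]
    have e1 : (fun t => c (x :: y :: t)) = fun t => -koszul x y * c (y :: x :: t) :=
      funext fun t => hc.head x y t
    rw [e1, listWedge_smul, koszul_comm y x]
    have h := koszul_mul_self (K := K) x y
    linear_combination (- φ y * passSign y r * c (x :: r)) * h
  | cons w l ih =>
    simp only [List.cons_append, Buttin.listWedge]
    have h1 := ih (hc.curry w)
    simp only at h1
    rw [h1, hc l x y r, passSign_swap]; ring

/-! ### The weight grading -/

theorem listLie_weight_mul (x : Gen) (l : List Gen) (f : ℤ → K) (c : List Gen → K) :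
    listLie x l (fun t => f (listWeight t) * c t) =
      f (x.weight + listWeight l) * listLie x l c := by
  induction l generalizing c f with
  | nil => simp [listLie]
  | cons y r ih =>
    simp only [listLie, listWeight_cons]
    rw [ih (fun w => f (y.weight + w)) (fun t => c (y :: t))]
    by_cases h : (brCoeff x y : K) = 0
    · rw [h]; ring_nf
    · rw [weight_br h]; ring_nf

/-- The bracket preserves weight, so the differential commutes with any function of the weight. The
functions used later are the indicator of 0 and the inverse. -/
theorem listDiff_weight_mul (l : List Gen) (f : ℤ → K) (c : List Gen → K) :
    listDiff l (fun t => f (listWeight t) * c t) = f (listWeight l) * listDiff l c := by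
  induction l generalizing c f with
  | nil => simp [listDiff]
  | cons y r ih =>
    simp only [listDiff, listWeight_cons, listLie_weight_mul]
    rw [ih (fun w => f (y.weight + w)) (fun t => c (y :: t))]
    ring

/-- `E 1` is the Euler field that diagonalizes the grading. The recursion defining `listDiff` is
Cartan's formula for the contraction with the first entry, so this identity provides the contracting
homotopy in nonzero weight. -/
theorem listLie_euler (l : List Gen) (c : List Gen → K) :
    listLie (E 1) l c = listWeight l * c l := by
  induction l generalizing c with
  | nil => simp [listLie]
  | cons y r ih =>
    rw [listLie, ih]
    rcases y with i | i <;> simp [brCoeff, br, koszul, weight] <;> ring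

/-- A function of lists is supported in weight zero. -/
def WeightZero (c : List Gen → K) : Prop := ∀ l, listWeight l ≠ 0 → c l = 0

theorem WeightZero.listDiff {c : List Gen → K} (hc : WeightZero c) :
    WeightZero (fun l => listDiff l c) := by
  intro l hl
  have h : c = fun t => (if listWeight t = 0 then 1 else 0) * c t := by
    funext t
    by_cases ht : listWeight t = 0
    · simp [ht]
    · simp [hc t ht]
  show Buttin.listDiff l c = 0
  rw [h, listDiff_weight_mul l (fun w => if w = 0 then 1 else 0)]
  simp [hl]

theorem listWedge_eq_zero {φ : Gen → K} {v w : ℤ} (hφ : ∀ z : Gen, z.weight ≠ v → φ z = 0)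
    {c : List Gen → K} (hc : ∀ l, listWeight l ≠ w → c l = 0) (l : List Gen)
    (hl : listWeight l ≠ w + v) : listWedge φ l c = 0 := by
  induction l generalizing c w with
  | nil => rfl
  | cons x l ih =>
    rw [listWeight_cons] at hl
    rw [listWedge, ih (w := w - x.weight) (fun t ht => hc _ (by rw [listWeight_cons]; omega))
      (by omega)]
    by_cases hx : x.weight = v
    · rw [hc l (by omega)]; simp
    · simp [hφ x hx]

theorem listWeight_perm {l l' : List Gen} (h : l.Perm l') : listWeight l = listWeight l' :=
  (h.map _).sum_eq

theorem exists_perm_cons {x : Gen} {l : List Gen} (h : x ∈ l) : ∃ l', l.Perm (x :: l') := by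
  obtain ⟨s, t, rfl⟩ := List.append_of_mem h
  exact ⟨s ++ t, List.perm_middle⟩

theorem listWeight_nonneg {l : List Gen} (h : ∀ z ∈ l, 0 ≤ z.weight) : 0 ≤ listWeight l := by
  refine List.sum_nonneg fun w hw => ?_
  obtain ⟨z, hz, rfl⟩ := List.mem_map.1 hw
  exact h z hz

theorem listWeight_nonpos {l : List Gen} (h : ∀ z ∈ l, z.weight ≤ 0) : listWeight l ≤ 0 := by
  induction l with
  | nil => rfl
  | cons x l ih =>
    rw [listWeight_cons]
    exact add_nonpos (h x (by simp)) (ih fun z hz => h z (by simp [hz]))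

theorem weight_nonneg {z : Gen} (h : z ≠ E 0) : 0 ≤ z.weight := by
  rcases z with i | i
  · have : i ≠ 0 := fun h0 => h (by rw [h0])
    simp only [weight]; omega
  · simp [weight]

/-! ### Classification of the weight-zero lists -/

/-- A list of monomials `1`. -/
abbrev ones (n : ℕ) : List Gen := List.replicate n (O 0)

/-- Without `E 0` all weights are nonnegative, so each of them is 0 and only `E 1` and `O 0` occur;
skewness allows `E 1` at most once. -/
theorem perm_of_weight_zero [CharZero K] {c : List Gen → K} (hc : ListSkew c) {l : List Gen}
    (h : ∀ z ∈ l, z ≠ E 0) (hw : listWeight l = 0) (hl : c l ≠ 0) :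
    ∃ n, l.Perm (ones n) ∨ l.Perm (E 1 :: ones n) := by
  have key : ∀ t : List Gen, (∀ z ∈ t, z ≠ E 0) → listWeight t = 0 →
      ∀ z ∈ t, z = E 1 ∨ z = O 0 := by
    intro t ht hw z hz
    obtain ⟨t', hp⟩ := exists_perm_cons hz
    have h1 := listWeight_perm hp
    rw [listWeight_cons] at h1
    have h2 : 0 ≤ listWeight t' := listWeight_nonneg fun y hy =>
      weight_nonneg (ht y (hp.mem_iff.2 (by simp [hy])))
    have h3 := weight_nonneg (ht z hz)
    have h4 : z.weight = 0 := by omega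
    rcases z with i | i <;> simp only [weight] at h4
    · left; congr 1; omega
    · right; congr 1; omega
  by_cases h1 : E 1 ∈ l
  · obtain ⟨l', hp⟩ := exists_perm_cons h1
    refine ⟨l'.length, Or.inr (hp.trans (List.Perm.cons _ ?_))⟩
    rw [List.eq_replicate_of_mem (a := O 0) (l := l')]
    · simp
    intro z hz
    have hz' : z ∈ l := hp.mem_iff.2 (by simp [hz])
    rcases key l h hw z hz' with rfl | h2
    · obtain ⟨l'', hp'⟩ := exists_perm_cons hz
      exact absurd (hc.perm_eq_zero (hp.trans (hp'.cons _)) (hc.repeat_eq_zero 1 l'')) hl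
    · exact h2
  · refine ⟨l.length, Or.inl ?_⟩
    rw [List.eq_replicate_of_mem (a := O 0) (l := l)]
    · simp
    intro z hz
    rcases key l h hw z hz with rfl | h2
    · exact absurd hz h1
    · exact h2

/-- The entry `E 0` occurs at most once. If it is absent, `perm_of_weight_zero` applies; if present,
its weight -1 is balanced by exactly one entry of weight 1, which is `E 2` or `O 1`. -/
theorem ListSkew.eq_zero_of_canonical [CharZero K] {c : List Gen → K} (hc : ListSkew c)
    (hw : WeightZero c)
    (h1 : ∀ n, c (ones n) = 0) (h2 : ∀ n, c (E 1 :: ones n) = 0)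
    (h3 : ∀ n, c (E 0 :: E 2 :: ones n) = 0) (h4 : ∀ n, c (E 0 :: O 1 :: ones n) = 0)
    (h5 : ∀ n, c (E 0 :: E 1 :: E 2 :: ones n) = 0)
    (h6 : ∀ n, c (E 0 :: E 1 :: O 1 :: ones n) = 0) (l : List Gen) : c l = 0 := by
  by_contra hl
  have hwl : listWeight l = 0 := by
    by_contra h
    exact hl (hw l h)
  by_cases h0 : E 0 ∈ l
  · obtain ⟨l', hp⟩ := exists_perm_cons h0
    have hl' : c (E 0 :: l') ≠ 0 := fun h => hl (hc.perm_eq_zero hp h)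
    have hn : ∀ z ∈ l', z ≠ E 0 := by
      rintro z hz rfl
      obtain ⟨l'', hp'⟩ := exists_perm_cons hz
      exact hl' (hc.perm_eq_zero (hp'.cons _) (hc.repeat_eq_zero 0 l''))
    have hw' : listWeight l' = 1 := by
      have := listWeight_perm hp
      simp only [listWeight_cons, weight] at this
      push_cast at this
      omega
    -- The remaining weights are nonnegative integers with sum 1, so one of them is 1 and the others
    -- are 0.
    obtain ⟨z, hz, hzw⟩ : ∃ z ∈ l', 0 < z.weight := by
      by_contra hcon
      push Not at hcon
      have := listWeight_nonpos hcon
      omega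
    obtain ⟨l'', hp'⟩ := exists_perm_cons hz
    have hn'' : ∀ y ∈ l'', y ≠ E 0 := fun y hy => hn y (hp'.mem_iff.2 (by simp [hy]))
    have hw'' := listWeight_perm hp'
    rw [listWeight_cons] at hw''
    have hge : 0 ≤ listWeight l'' := listWeight_nonneg fun y hy => weight_nonneg (hn'' y hy)
    have hl'' : c (E 0 :: z :: l'') ≠ 0 := fun h => hl' (hc.perm_eq_zero (hp'.cons _) h)
    have hz1 : z = E 2 ∨ z = O 1 := by
      have : z.weight = 1 := by omega
      rcases z with i | i <;> simp only [weight] at this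
      · left; congr 1; omega
      · right; congr 1; omega
    obtain ⟨n, hpn | hpn⟩ := perm_of_weight_zero ((hc.curry (E 0)).curry z) hn'' (by omega) hl''
    · refine hl'' (hc.perm_eq_zero ((hpn.cons _).cons _) ?_)
      rcases hz1 with rfl | rfl
      exacts [h3 n, h4 n]
    · refine hl'' (hc.perm_eq_zero (((hpn.cons _).trans (List.Perm.swap _ _ _)).cons _) ?_)
      rcases hz1 with rfl | rfl
      exacts [h5 n, h6 n]
  · obtain ⟨n, hpn | hpn⟩ := perm_of_weight_zero hc (fun z hz h => h0 (h ▸ hz)) hwl hl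
    · exact hl (hc.perm_eq_zero hpn (h1 n))
    · exact hl (hc.perm_eq_zero hpn (h2 n))

/-! ### The differential on the weight-zero families -/

theorem listLie_ones (x : Gen) (n : ℕ) (c : List Gen → K) : listLie x (ones n) c = 0 := by
  induction n generalizing c with
  | zero => rfl
  | succ n ih =>
    rw [ones, List.replicate_succ, listLie, ih]
    cases x <;> simp [brCoeff]

theorem listDiff_ones (n : ℕ) (c : List Gen → K) : listDiff (ones n) c = 0 := by
  induction n generalizing c with
  | zero => rfl
  | succ n ih => rw [ones, List.replicate_succ, listDiff, ih, listLie_ones, sub_zero]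

theorem listDiff_one (x : Gen) (n : ℕ) (c : List Gen → K) : listDiff (x :: ones n) c = 0 := by
  rw [listDiff, listDiff_ones, listLie_ones, sub_zero]

theorem listDiff_two (x y : Gen) (n : ℕ) (c : List Gen → K) :
    listDiff (x :: y :: ones n) c = -(brCoeff x y * c (br x y :: ones n)) := by
  rw [listDiff, listDiff_one, listLie, listLie_ones]; ring

theorem listDiff_three (x y z : Gen) (n : ℕ) (c : List Gen → K) :
    listDiff (x :: y :: z :: ones n) c = -(brCoeff x y * c (br x y :: z :: ones n)) -
      koszul x y * (brCoeff x z * c (y :: br x z :: ones n)) +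
        brCoeff y z * c (x :: br y z :: ones n) := by
  rw [listDiff, listDiff_two, listLie, listLie, listLie_ones]; ring

theorem listDiff_E0_E2 (n : ℕ) (c : List Gen → K) :
    listDiff (E 0 :: E 2 :: ones n) c = 2 * c (E 1 :: ones n) := by
  simp [listDiff_two, brCoeff, br]

theorem listDiff_E0_O1 (n : ℕ) (c : List Gen → K) :
    listDiff (E 0 :: O 1 :: ones n) c = c (ones (n + 1)) := by
  simp [listDiff_two, brCoeff, br, List.replicate_succ]

/-- The brackets of `E 1` with `E 0` and with `E 2` contribute opposite multiples of `c (E 0 :: E 2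
:: ones n)`, because `E 0` and `E 2` have opposite weights. What is left has `E 1` twice. -/
theorem listDiff_E0_E1_E2 [CharZero K] (n : ℕ) {c : List Gen → K} (hc : ListSkew c) :
    listDiff (E 0 :: E 1 :: E 2 :: ones n) c = 0 := by
  have := hc.repeat_eq_zero 1 (ones n)
  simp [listDiff_three, brCoeff, br, this]
  ring

theorem listDiff_E0_E1_O1 (n : ℕ) (c : List Gen → K) :
    listDiff (E 0 :: E 1 :: O 1 :: ones n) c = c (E 1 :: ones (n + 1)) := by
  simp [listDiff_three, brCoeff, br, koszul, List.replicate_succ]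

/-- The sufficient half of the cocycle criterion in weight zero: the values on the six families
involve `c` only through the two vanishing ones. -/
theorem ListSkew.listDiff_eq_zero [CharZero K] {c : List Gen → K} (hc : ListSkew c)
    (hw : WeightZero c) (h1 : ∀ n, c (ones (n + 1)) = 0) (h2 : ∀ n, c (E 1 :: ones n) = 0)
    (l : List Gen) : Buttin.listDiff l c = 0 :=
  hc.listDiff.eq_zero_of_canonical hw.listDiff (fun n => listDiff_ones n c)
    (fun n => listDiff_one _ n c) (fun n => by rw [listDiff_E0_E2, h2, mul_zero])
    (fun n => by rw [listDiff_E0_O1, h1]) (fun n => listDiff_E0_E1_E2 n hc)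
    (fun n => by rw [listDiff_E0_E1_O1, h2]) l

end ListModel

/-! ### Forms of finite order and their values on monomials -/

section Forms
variable {K : Type*} [Field K]

/-- The basis monomials of `B(1)`. -/
noncomputable def mono : Gen → B1 K
  | E i => TrivSqZeroExt.inr (PowerSeries.monomial i 1)
  | O i => TrivSqZeroExt.inl (PowerSeries.monomial i 1)

/-- Equality of Taylor coefficients of order less than `N`. -/
def Agree (N : ℕ) (f g : B1 K) : Prop :=
  ∀ n < N, PowerSeries.coeff n f.fst = PowerSeries.coeff n g.fst ∧
    PowerSeries.coeff n f.snd = PowerSeries.coeff n g.snd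

theorem Agree.refl (N : ℕ) (f : B1 K) : Agree N f f := fun _ _ => ⟨rfl, rfl⟩

theorem Agree.mono {M N : ℕ} (h : M ≤ N) {f g : B1 K} (hfg : Agree N f g) : Agree M f g :=
  fun n hn => hfg n (hn.trans_le h)

/-- A functional of finite order sees only a Taylor polynomial, which is a finite combination of
monomials. -/
theorem eq_zero_of_mono (f : B1 K →ₗ[K] K) (N : ℕ) (hf : ∀ x y, Agree N x y → f x = f y)
    (h : ∀ z, f (mono z) = 0) (x : B1 K) : f x = 0 := by
  have : f x = f (∑ i ∈ Finset.range N, (PowerSeries.coeff i x.fst • mono (O i) +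
      PowerSeries.coeff i x.snd • mono (E i))) := by
    refine hf _ _ fun n hn => ?_
    simp [mono, TrivSqZeroExt.fst_sum, TrivSqZeroExt.snd_sum, PowerSeries.coeff_monomial, hn]
  rw [this, map_sum]
  exact Finset.sum_eq_zero fun i _ => by simp [h]

variable (K) in
/-- Multilinear forms of finite order. -/
def forms (k : ℕ) : Submodule K ((Fin k → B1 K) → K) where
  carrier := {C | (∃ M : MultilinearMap K (fun _ : Fin k => B1 K) K, ∀ a, M a = C a) ∧
    IsFiniteOrder C}
  zero_mem' := ⟨⟨0, fun _ => rfl⟩, 0, fun _ _ _ => rfl⟩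
  add_mem' := by
    rintro C D ⟨⟨M, hM⟩, N, hN⟩ ⟨⟨M', hM'⟩, N', hN'⟩
    refine ⟨⟨M + M', fun a => by simp [hM, hM']⟩, max N N', fun a b hab => ?_⟩
    simp only [Pi.add_apply]
    rw [hN a b fun i n hn => hab i n (lt_max_of_lt_left hn),
      hN' a b fun i n hn => hab i n (lt_max_of_lt_right hn)]
  smul_mem' := by
    rintro c C ⟨⟨M, hM⟩, N, hN⟩
    exact ⟨⟨c • M, fun a => by simp [hM]⟩, N, fun a b hab => by simp [hN a b hab]⟩

theorem mem_cochains {k : ℕ} {C : (Fin k → B1 K) → K} :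
    C ∈ cochains K k ↔ C ∈ forms K k ∧ IsSuperSkew C :=
  ⟨fun h => ⟨⟨h.1, h.2.2⟩, h.2.1⟩, fun h => ⟨h.1.1, h.2, h.1.2⟩⟩

/-- Insertion of a fixed first argument. -/
noncomputable def insertHead {k : ℕ} (x : B1 K) :
    ((Fin (k + 1) → B1 K) → K) →ₗ[K] ((Fin k → B1 K) → K) :=
  LinearMap.funLeft K K fun a => (Fin.cons x a : Fin (k + 1) → B1 K)

theorem insertHead_apply {k : ℕ} (x : B1 K) (C : (Fin (k + 1) → B1 K) → K) (a : Fin k → B1 K) :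
    insertHead x C a = C (Fin.cons x a) := rfl

theorem agree_cons {k N : ℕ} {x y : B1 K} {a b : Fin k → B1 K} (h : Agree N x y)
    (hab : ∀ i, Agree N (a i) (b i)) (i : Fin (k + 1)) :
    Agree N ((Fin.cons x a : Fin (k + 1) → B1 K) i) ((Fin.cons y b : Fin (k + 1) → B1 K) i) := by
  cases i using Fin.cases with
  | zero => exact h
  | succ i => exact hab i

theorem insertHead_mem_forms {k : ℕ} {C : (Fin (k + 1) → B1 K) → K} (hC : C ∈ forms K (k + 1))
    (x : B1 K) : insertHead x C ∈ forms K k := by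
  obtain ⟨⟨M, hM⟩, N, hN⟩ := hC
  exact ⟨⟨M.curryLeft x, fun a => by rw [MultilinearMap.curryLeft_apply, hM]; rfl⟩, N,
    fun a b hab => hN _ _ (agree_cons (Agree.refl N x) hab)⟩

theorem exists_head {k : ℕ} {C : (Fin (k + 1) → B1 K) → K} (hC : C ∈ forms K (k + 1)) :
    ∃ N, ∀ a : Fin k → B1 K, ∃ f : B1 K →ₗ[K] K, (∀ x, f x = C (Fin.cons x a)) ∧
      ∀ x y, Agree N x y → f x = f y := by
  obtain ⟨⟨M, hM⟩, N, hN⟩ := hC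
  refine ⟨N, fun a => ⟨⟨⟨fun x => C (Fin.cons x a), fun x y => ?_⟩, fun c x => ?_⟩, fun x => rfl,
    fun x y hxy => hN _ _ (agree_cons hxy fun i => Agree.refl N _)⟩⟩
  · simp only [← hM, MultilinearMap.cons_add]
  · simp only [← hM, MultilinearMap.cons_smul, RingHom.id_apply]

/-- Evaluation of a form at a list of monomials. -/
noncomputable def evalList : (k : ℕ) → List Gen → ((Fin k → B1 K) → K) →ₗ[K] K
  | 0, [] => LinearMap.proj Fin.elim0
  | 0, _ :: _ => 0
  | _ + 1, [] => 0
  | k + 1, x :: l => (evalList k l).comp (insertHead (mono x))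

theorem evalList_cons {k : ℕ} (x : Gen) (l : List Gen) (C : (Fin (k + 1) → B1 K) → K) :
    evalList (k + 1) (x :: l) C = evalList k l (insertHead (mono x) C) := rfl

/-- The default value 0 on lists of the wrong length lets later conditions range over all `n`
without fixing the degree. -/
theorem evalList_of_length_ne {k : ℕ} {l : List Gen} (h : l.length ≠ k)
    (C : (Fin k → B1 K) → K) : evalList k l C = 0 := by
  induction l generalizing k with
  | nil =>
    cases k with
    | zero => simp at h
    | succ k => rfl
  | cons x l ih =>
    cases k with
    | zero => rfl
    | succ k => exact ih (fun h' => h (by simp [h'])) _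

theorem forms_eq_zero {k : ℕ} {C : (Fin k → B1 K) → K} (hC : C ∈ forms K k)
    (h : ∀ l : List Gen, l.length = k → evalList k l C = 0) : C = 0 := by
  induction k with
  | zero =>
    funext a
    rw [Subsingleton.elim a Fin.elim0]
    exact h [] rfl
  | succ k ih =>
    obtain ⟨N, hN⟩ := exists_head hC
    funext a
    obtain ⟨f, hf, hfN⟩ := hN (Fin.tail a)
    rw [← Fin.cons_self_tail a, ← hf]
    refine eq_zero_of_mono f N hfN (fun z => ?_) _
    rw [hf]
    exact congrFun (ih (insertHead_mem_forms hC (mono z)) fun l hl => h (z :: l) (by simp [hl])) _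

theorem forms_ext {k : ℕ} {C D : (Fin k → B1 K) → K} (hC : C ∈ forms K k) (hD : D ∈ forms K k)
    (h : ∀ l : List Gen, l.length = k → evalList k l C = evalList k l D) : C = D :=
  sub_eq_zero.1 (forms_eq_zero (Submodule.sub_mem _ hC hD) fun l hl => by
    rw [map_sub, h l hl, sub_self])

theorem mul_mem_forms {k : ℕ} (φ : B1 K →ₗ[K] K) {N : ℕ} (hφ : ∀ x y, Agree N x y → φ x = φ y)
    {D : (Fin k → B1 K) → K} (hD : D ∈ forms K k) :
    (fun a : Fin (k + 1) → B1 K => φ (a 0) * D (Fin.tail a)) ∈ forms K (k + 1) := by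
  obtain ⟨⟨M, hM⟩, N', hN'⟩ := hD
  refine ⟨⟨LinearMap.uncurryLeft (φ.smulRight M), fun a => by simp [hM]⟩, max N N',
    fun a b hab => ?_⟩
  have h1 := hφ _ _ (Agree.mono (le_max_left N N') (hab 0))
  have h2 := hN' (Fin.tail a) (Fin.tail b)
    fun i => Agree.mono (le_max_right N N') (hab i.succ)
  simp only [h1, h2]

theorem insertHead_mul {k : ℕ} (φ : B1 K →ₗ[K] K) (D : (Fin k → B1 K) → K) (x : B1 K) :
    insertHead x (fun a : Fin (k + 1) → B1 K => φ (a 0) * D (Fin.tail a)) = φ x • D := rfl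

/-- A function of lists which vanishes on lists containing a monomial of large degree. -/
def ListFinite (c : List Gen → K) : Prop :=
  ∃ N, ∀ l, ∀ z ∈ l, N ≤ z.index → c l = 0

variable (K) in
/-- The coefficient of a monomial, as a linear functional. -/
noncomputable def coeffGen (z : Gen) : B1 K →ₗ[K] K where
  toFun f := match z with
    | E i => cE K i f
    | O i => cO K i f
  map_add' f g := by cases z <;> simp [cE, cO]
  map_smul' t f := by cases z <;> simp [cE, cO]

theorem coeffGen_agree (z : Gen) (x y : B1 K) (h : Agree (z.index + 1) x y) :
    coeffGen K z x = coeffGen K z y := by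
  cases z with
  | E i => exact (h i (Nat.lt_succ_self i)).2
  | O i => exact (h i (Nat.lt_succ_self i)).1

theorem cE_mono_E (i j : ℕ) : cE K i (mono (E j)) = if i = j then 1 else 0 := by
  simp [cE, mono, PowerSeries.coeff_monomial]

theorem cE_mono_O (i j : ℕ) : cE K i (mono (O j)) = 0 := by
  simp [cE, mono]

theorem cO_mono_O (i j : ℕ) : cO K i (mono (O j)) = if i = j then 1 else 0 := by
  simp [cO, mono, PowerSeries.coeff_monomial]

theorem cO_mono_E (i j : ℕ) : cO K i (mono (E j)) = 0 := by
  simp [cO, mono]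

theorem coeffGen_mono (z w : Gen) [Decidable (z = w)] :
    coeffGen K z (mono w) = if z = w then 1 else 0 := by
  rcases z with i | i <;> rcases w with j | j
  · show cE K i (mono (E j)) = _
    simp [cE_mono_E]
  · show cE K i (mono (O j)) = _
    simp [cE_mono_O]
  · show cO K i (mono (E j)) = _
    simp [cO_mono_E]
  · show cO K i (mono (O j)) = _
    simp [cO_mono_O]

/-- Finite support turns the expansion in the first argument, dual functional times a form in the
other arguments, into a finite sum. -/
theorem exists_form {c : List Gen → K} (hc : ListFinite c) (k : ℕ) :
    ∃ C ∈ forms K k, ∀ l : List Gen, l.length = k → evalList k l C = c l := by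
  classical
  induction k generalizing c with
  | zero =>
    refine ⟨fun _ => c [], ⟨⟨MultilinearMap.constOfIsEmpty K _ (c []), fun _ => rfl⟩, 0,
      fun _ _ _ => rfl⟩, fun l hl => ?_⟩
    rw [List.length_eq_zero_iff.1 hl]
    rfl
  | succ k ih =>
    obtain ⟨N, hN⟩ := hc
    choose D hD hDc using fun z : Gen => ih (c := fun l => c (z :: l))
      ⟨N, fun l y hy hyN => hN _ y (by simp [hy]) hyN⟩
    refine ⟨∑ i ∈ Finset.range N,
      ((fun a => coeffGen K (E i) (a 0) * D (E i) (Fin.tail a)) +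
        fun a => coeffGen K (O i) (a 0) * D (O i) (Fin.tail a)),
      Submodule.sum_mem _ fun i _ => Submodule.add_mem _
        (mul_mem_forms _ (coeffGen_agree _) (hD _)) (mul_mem_forms _ (coeffGen_agree _) (hD _)),
      fun l hl => ?_⟩
    obtain _ | ⟨z, l⟩ := l
    · simp at hl
    have hl' : l.length = k := by simpa using hl
    rw [evalList_cons, map_sum, map_sum]
    simp only [map_add, insertHead_mul, map_smul, coeffGen_mono, hDc _ l hl']
    rcases z with j | j
    · by_cases hj : j < N
      · simp [Finset.sum_ite_eq', hj]
      · simp [Finset.sum_ite_eq', hj, hN (E j :: l) (E j) (by simp) (not_lt.1 hj)]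
    · by_cases hj : j < N
      · simp [Finset.sum_ite_eq', hj]
      · simp [Finset.sum_ite_eq', hj, hN (O j :: l) (O j) (by simp) (not_lt.1 hj)]

theorem listFinite_evalList {k : ℕ} {C : (Fin k → B1 K) → K} (hC : C ∈ forms K k) :
    ListFinite (fun l => evalList k l C) := by
  obtain ⟨⟨M, hM⟩, N, hN⟩ := hC
  have key : ∀ (m : ℕ) (D : (Fin m → B1 K) → K), (∀ a b, (∀ i, Agree N (a i) (b i)) → D a = D b) →
      (∀ a i, a i = 0 → D a = 0) → ∀ (l : List Gen), ∀ z ∈ l, N ≤ z.index →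
        evalList m l D = 0 := by
    intro m
    induction m with
    | zero =>
      intro D _ _ l z hz _
      cases l with
      | nil => simp at hz
      | cons y l => rfl
    | succ m ih =>
      intro D h1 h2 l z hz hzN
      cases l with
      | nil => rfl
      | cons y l =>
        rw [evalList_cons]
        rcases List.mem_cons.1 hz with rfl | hz
        · have : insertHead (mono z) D = 0 := by
            funext a
            rw [insertHead_apply, h1 (Fin.cons (mono z) a) (Fin.cons 0 a)
              (agree_cons (fun n hn => ?_) fun i => Agree.refl N _)]
            · exact h2 _ 0 rfl
            · rcases z with i | i <;> simp only [index] at hzN <;>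
                simp [mono, PowerSeries.coeff_monomial, (hn.trans_le hzN).ne]
          rw [this, map_zero]
        · refine ih _ (fun a b hab => h1 _ _ (agree_cons (Agree.refl N _) hab))
            (fun a i ha => h2 _ i.succ (by simp [ha])) l z hz hzN
  exact ⟨N, fun l z hz hzN => key k C hN (fun a i h => by
    rw [← hM]; exact M.map_coord_zero i h) l z hz hzN⟩

end Forms

/-! ### Super skew-symmetry tested on monomials -/

section Skew
variable {K : Type*} [Field K]

theorem cons_comp_swap_succ {k : ℕ} (x : B1 K) (a : Fin k → B1 K) (i j : Fin k) :
    (Fin.cons x a : Fin (k + 1) → B1 K) ∘ Equiv.swap i.succ j.succ =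
      Fin.cons x (a ∘ Equiv.swap i j) := by
  funext l
  cases l using Fin.cases with
  | zero =>
    rw [Function.comp_apply, Equiv.swap_apply_of_ne_of_ne (Fin.succ_ne_zero _).symm
      (Fin.succ_ne_zero _).symm]
    rfl
  | succ l =>
    rw [Function.comp_apply, (Fin.succ_injective k).swap_apply]
    rfl

theorem cons_cons_comp_swap {k : ℕ} (x y : B1 K) (a : Fin k → B1 K) :
    (Fin.cons x (Fin.cons y a : Fin (k + 1) → B1 K) : Fin (k + 2) → B1 K) ∘ Equiv.swap 0 1 =
      Fin.cons y (Fin.cons x a : Fin (k + 1) → B1 K) := by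
  funext l
  cases l using Fin.cases with
  | zero => simp
  | succ l =>
    cases l using Fin.cases with
    | zero => simp
    | succ l =>
      have h : l.succ.succ ≠ 1 := fun h => Fin.succ_ne_zero _ (Fin.succ_injective _ h)
      rw [Function.comp_apply, Equiv.swap_apply_of_ne_of_ne (Fin.succ_ne_zero _) h]
      rfl

theorem IsSuperSkew.insertHead {k : ℕ} {C : (Fin (k + 1) → B1 K) → K} (hC : IsSuperSkew C)
    (x : B1 K) : IsSuperSkew (insertHead x C) := fun a i j hij => by
  have := hC (Fin.cons x a) i.succ j.succ (by simp [← hij])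
  rw [cons_comp_swap_succ] at this
  exact this

theorem insertHead_mem_cochains {k : ℕ} {C : (Fin (k + 1) → B1 K) → K}
    (hC : C ∈ cochains K (k + 1)) (x : B1 K) : insertHead x C ∈ cochains K k :=
  mem_cochains.2 ⟨insertHead_mem_forms (mem_cochains.1 hC).1 x, (mem_cochains.1 hC).2.insertHead x⟩

theorem IsSuperSkew.swap_head {k : ℕ} {C : (Fin (k + 2) → B1 K) → K} (hC : IsSuperSkew C)
    (x y : B1 K) (a : Fin k → B1 K) :
    (IsOdd x → IsOdd y → C (Fin.cons y (Fin.cons x a : Fin (k + 1) → B1 K)) =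
      C (Fin.cons x (Fin.cons y a : Fin (k + 1) → B1 K))) ∧
    (IsEven x ∨ IsEven y → C (Fin.cons y (Fin.cons x a : Fin (k + 1) → B1 K)) =
      -C (Fin.cons x (Fin.cons y a : Fin (k + 1) → B1 K))) := by
  have := hC (Fin.cons x (Fin.cons y a : Fin (k + 1) → B1 K)) 0 1 rfl
  rw [cons_cons_comp_swap] at this
  exact this

theorem IsSuperSkew.insertHead_comm {k : ℕ} {C : (Fin (k + 2) → B1 K) → K} (hC : IsSuperSkew C)
    (x y : Gen) : Buttin.insertHead (mono y) (Buttin.insertHead (mono x) C) =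
      (-koszul x y : K) • Buttin.insertHead (mono x) (Buttin.insertHead (mono y) C) := by
  funext a
  have h := hC.swap_head (mono y) (mono x) a
  simp only [insertHead_apply, Pi.smul_apply, smul_eq_mul]
  rcases x with i | i <;> rcases y with j | j <;> simp only [koszul]
  · rw [h.2 (Or.inl rfl)]; ring
  · rw [h.2 (Or.inr rfl)]; ring
  · rw [h.2 (Or.inl rfl)]; ring
  · rw [h.1 rfl rfl]; ring

theorem IsSuperSkew.listSkew {k : ℕ} {C : (Fin k → B1 K) → K} (hC : IsSuperSkew C) :
    ListSkew (fun l => evalList k l C) := by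
  intro l x y r
  induction l generalizing k with
  | nil =>
    match k, C, hC with
    | 0, _, _ => simp [evalList]
    | 1, _, _ => simp [evalList]
    | k + 2, C, hC =>
      simp only [List.nil_append, evalList_cons]
      rw [hC.insertHead_comm x y, map_smul, smul_eq_mul]
  | cons z l ih =>
    cases k with
    | zero => simp [evalList]
    | succ k => exact ih (hC.insertHead (mono z))

theorem evenPart_add (f g : B1 K) : evenPart (f + g) = evenPart f + evenPart g := by
  ext <;> simp [evenPart]

theorem evenPart_smul (t : K) (f : B1 K) : evenPart (t • f) = t • evenPart f := by
  ext <;> simp [evenPart]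

theorem oddPart_add (f g : B1 K) : oddPart (f + g) = oddPart f + oddPart g := by
  ext <;> simp [oddPart]

theorem oddPart_smul (t : K) (f : B1 K) : oddPart (t • f) = t • oddPart f := by
  ext <;> simp [oddPart]

variable (K) in
noncomputable def evenLin : B1 K →ₗ[K] B1 K := ⟨⟨evenPart, evenPart_add⟩, evenPart_smul⟩

variable (K) in
noncomputable def oddLin : B1 K →ₗ[K] B1 K := ⟨⟨oddPart, oddPart_add⟩, oddPart_smul⟩

theorem Agree.evenPart {N : ℕ} {f g : B1 K} (h : Agree N f g) :
    Agree N (evenPart f) (evenPart g) := fun n hn => by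
  simpa [Buttin.evenPart] using (h n hn).2

theorem Agree.oddPart {N : ℕ} {f g : B1 K} (h : Agree N f g) :
    Agree N (oddPart f) (oddPart g) := fun n hn => by
  simpa [Buttin.oddPart] using (h n hn).1

theorem oddPart_mono_E (i : ℕ) : oddPart (mono (E i) : B1 K) = 0 := by
  ext <;> simp [oddPart, mono]

theorem oddPart_mono_O (i : ℕ) : oddPart (mono (O i) : B1 K) = mono (O i) := by
  ext <;> simp [oddPart, mono]

theorem evenPart_mono_E (i : ℕ) : evenPart (mono (E i) : B1 K) = mono (E i) := by
  ext <;> simp [evenPart, mono]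

theorem evenPart_mono_O (i : ℕ) : evenPart (mono (O i) : B1 K) = 0 := by
  ext <;> simp [evenPart, mono]

theorem oddPart_of_isOdd {f : B1 K} (h : IsOdd f) : oddPart f = f := by
  ext
  · simp [oddPart]
  · simp [oddPart, show f.snd = 0 from h]

theorem oddPart_of_isEven {f : B1 K} (h : IsEven f) : oddPart f = 0 := by
  ext <;> simp [oddPart, show f.fst = 0 from h]

/-- The form which vanishes if and only if `C` is super skew-symmetric in the positions `i`, `j`. -/
noncomputable def skewDefect {k : ℕ} (i j : Fin k) (C : (Fin k → B1 K) → K) :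
    (Fin k → B1 K) → K :=
  fun a => C (a ∘ Equiv.swap i j) + C a -
    2 * C (fun l => if l = i ∨ l = j then oddPart (a l) else a l)

theorem skewDefect_mem_forms {k : ℕ} (i j : Fin k) {C : (Fin k → B1 K) → K}
    (hC : C ∈ forms K k) : skewDefect i j C ∈ forms K k := by
  obtain ⟨⟨M, hM⟩, N, hN⟩ := hC
  refine ⟨⟨M.domDomCongr (Equiv.swap i j) + M - (2 : K) • M.compLinearMap
    (fun l => if l = i ∨ l = j then oddLin K else LinearMap.id), fun a => ?_⟩, N, fun a b hab => ?_⟩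
  · simp only [sub_apply, add_apply, smul_apply,
      MultilinearMap.domDomCongr_apply, MultilinearMap.compLinearMap_apply, hM, skewDefect,
      smul_eq_mul]
    congr 3
    funext l
    split_ifs <;> rfl
  · simp only [skewDefect]
    rw [hN a b hab, hN (a ∘ Equiv.swap i j) (b ∘ Equiv.swap i j) fun l => hab _]
    congr 2
    refine hN _ _ fun l => ?_
    split_ifs
    · exact Agree.oddPart (hab l)
    · exact hab l

theorem insertHead_skewDefect {k : ℕ} (i j : Fin k) (C : (Fin (k + 1) → B1 K) → K) (x : B1 K) :
    insertHead x (skewDefect i.succ j.succ C) = skewDefect i j (insertHead x C) := by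
  funext a
  simp only [insertHead_apply, skewDefect, cons_comp_swap_succ]
  congr 3
  funext l
  cases l using Fin.cases with
  | zero => simp [(Fin.succ_ne_zero _).symm]
  | succ l => simp

theorem insertHead_skewDefect_zero {k : ℕ} {C : (Fin (k + 2) → B1 K) → K}
    (hC : C ∈ forms K (k + 2)) (x y : Gen) :
    insertHead (mono y) (insertHead (mono x) (skewDefect 0 1 C)) =
      insertHead (mono x) (insertHead (mono y) C) +
        (koszul x y : K) • insertHead (mono y) (insertHead (mono x) C) := by
  obtain ⟨⟨M, hM⟩, -⟩ := hC
  funext a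
  simp only [insertHead_apply, skewDefect, cons_cons_comp_swap, Pi.add_apply, Pi.smul_apply,
    smul_eq_mul]
  have e : (fun l : Fin (k + 2) => if l = 0 ∨ l = 1 then
      oddPart ((Fin.cons (mono x) (Fin.cons (mono y) a : Fin (k + 1) → B1 K) :
        Fin (k + 2) → B1 K) l) else
      (Fin.cons (mono x) (Fin.cons (mono y) a : Fin (k + 1) → B1 K) : Fin (k + 2) → B1 K) l) =
      Fin.cons (oddPart (mono x)) (Fin.cons (oddPart (mono y)) a : Fin (k + 1) → B1 K) := by
    funext l
    cases l using Fin.cases with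
    | zero => simp
    | succ l =>
      cases l using Fin.cases with
      | zero => simp
      | succ l =>
        rw [if_neg]
        · rfl
        · rintro (h | h)
          · exact Fin.succ_ne_zero _ h
          · exact Fin.succ_ne_zero _ (Fin.succ_injective _ h)
  rw [e]
  rcases x with i | i
  · rw [oddPart_mono_E, ← hM (Fin.cons 0 _), M.map_coord_zero 0 rfl]
    cases y <;> simp [koszul]
  · rcases y with j | j
    · rw [oddPart_mono_E, ← hM (Fin.cons _ (Fin.cons 0 _)), M.map_coord_zero 1 rfl]
      simp [koszul]
    · rw [oddPart_mono_O, oddPart_mono_O]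
      simp only [koszul]
      ring

/-- Super skew-symmetry has separate rules for homogeneous arguments. `skewDefect` packs them into
one multilinear form, which can be tested on monomials. -/
theorem isSuperSkew_of_listSkew {k : ℕ} {C : (Fin k → B1 K) → K} (hC : C ∈ forms K k)
    (h : ListSkew (fun l => evalList k l C)) : IsSuperSkew C := by
  have key : ∀ (m : ℕ) (D : (Fin m → B1 K) → K), D ∈ forms K m →
      ListSkew (fun l => evalList m l D) → ∀ i j : Fin m, (i : ℕ) + 1 = j →
        skewDefect i j D = 0 := by
    intro m
    induction m with
    | zero => exact fun _ _ _ i => i.elim0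
    | succ m ih =>
      intro D hD hs i j hij
      refine forms_eq_zero (skewDefect_mem_forms i j hD) fun l hl => ?_
      obtain _ | ⟨x, l⟩ := l
      · rfl
      obtain ⟨j, rfl⟩ : ∃ j', j = Fin.succ j' := Fin.exists_succ_eq.2 (by
        rintro rfl
        simp at hij) |>.imp fun _ h => h.symm
      rw [evalList_cons]
      cases i using Fin.cases with
      | zero =>
        obtain _ | m := m
        · exact j.elim0
        obtain rfl : j = 0 := by
          ext
          simpa using hij.symm
        obtain _ | ⟨y, l⟩ := l
        · rfl
        rw [evalList_cons]
        have := insertHead_skewDefect_zero hD x y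
        rw [Fin.succ_zero_eq_one, this, map_add, map_smul]
        have h2 := hs.head y x l
        simp only [evalList_cons] at h2
        rw [h2, koszul_comm y x, smul_eq_mul]
        ring
      | succ i =>
        rw [insertHead_skewDefect, ih _ (insertHead_mem_forms hD _) (hs.curry x) i j
          (by simpa using hij), map_zero]
  intro a i j hij
  have h0 := congrFun (key k C hC h i j hij) a
  simp only [skewDefect, Pi.zero_apply] at h0
  obtain ⟨⟨M, hM⟩, -⟩ := hC
  refine ⟨fun hi hj => ?_, fun hor => ?_⟩
  · have e : (fun l => if l = i ∨ l = j then oddPart (a l) else a l) = a := by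
      funext l
      split_ifs with hl
      · rcases hl with rfl | rfl
        exacts [oddPart_of_isOdd hi, oddPart_of_isOdd hj]
      · rfl
    rw [e] at h0
    linear_combination h0
  · have e : C (fun l => if l = i ∨ l = j then oddPart (a l) else a l) = 0 := by
      rw [← hM]
      rcases hor with hi | hj
      · exact M.map_coord_zero i (by simp [oddPart_of_isEven hi])
      · exact M.map_coord_zero j (by simp [oddPart_of_isEven hj])
    rw [e] at h0
    linear_combination h0

theorem exists_cochain {c : List Gen → K} (hc : ListFinite c) (hs : ListSkew c) (k : ℕ) :
    ∃ C ∈ cochains K k, ∀ l : List Gen, l.length = k → evalList k l C = c l := by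
  obtain ⟨C, hC, h⟩ := exists_form hc k
  refine ⟨C, mem_cochains.2 ⟨hC, isSuperSkew_of_listSkew hC fun l x y r => ?_⟩, h⟩
  simp only
  by_cases hl : (l ++ x :: y :: r).length = k
  · rw [h _ hl, h _ (by simpa using hl), hs]
  · rw [evalList_of_length_ne hl, evalList_of_length_ne (by simpa using hl), mul_zero]

end Skew

/-! ### The bracket on monomials; differential and wedge preserve finite order -/

section Bracket
variable {K : Type*} [Field K]

theorem bracket_fst (f g : B1 K) : (bracket f g).fst =
    PowerSeries.derivative K f.fst * g.snd - f.snd * PowerSeries.derivative K g.fst := by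
  simp [bracket, dx, dX, grassmannSign, sub_eq_add_neg]

theorem bracket_snd (f g : B1 K) : (bracket f g).snd =
    PowerSeries.derivative K f.snd * g.snd - f.snd * PowerSeries.derivative K g.snd := by
  simp [bracket, dx, dX, grassmannSign, sub_eq_add_neg, mul_comm]

variable (K) in
/-- The bracket as a bilinear map. -/
noncomputable def bracketLin : B1 K →ₗ[K] B1 K →ₗ[K] B1 K :=
  LinearMap.mk₂ K bracket
    (fun f f' g => by
      ext1 <;> simp only [bracket_fst, bracket_snd, TrivSqZeroExt.fst_add, TrivSqZeroExt.snd_add,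
        map_add] <;> ring)
    (fun t f g => by
      ext1 <;> simp only [bracket_fst, bracket_snd, TrivSqZeroExt.fst_smul, TrivSqZeroExt.snd_smul,
        Derivation.map_smul, smul_mul_assoc, smul_sub])
    (fun f g g' => by
      ext1 <;> simp only [bracket_fst, bracket_snd, TrivSqZeroExt.fst_add, TrivSqZeroExt.snd_add,
        map_add] <;> ring)
    (fun t f g => by
      ext1 <;> simp only [bracket_fst, bracket_snd, TrivSqZeroExt.fst_smul, TrivSqZeroExt.snd_smul,
        Derivation.map_smul, mul_smul_comm, smul_sub])

theorem derivative_monomial (i : ℕ) :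
    PowerSeries.derivative K (PowerSeries.monomial i (1 : K)) = PowerSeries.monomial (i - 1) (i : K) := by
  ext n
  rw [PowerSeries.coeff_derivative, PowerSeries.coeff_monomial, PowerSeries.coeff_monomial]
  rcases i with _ | i
  · simp
  · by_cases h : n = i
    · simp [h]
    · simp [h]

theorem derivative_monomial_mul (i j : ℕ) :
    PowerSeries.derivative K (PowerSeries.monomial i (1 : K)) * PowerSeries.monomial j (1 : K) =
      (i : K) • PowerSeries.monomial (i + j - 1) (1 : K) := by
  rw [derivative_monomial, PowerSeries.monomial_mul_monomial, ← map_smul, smul_eq_mul]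
  rcases i with _ | i
  · simp
  · rw [show i + 1 - 1 + j = i + 1 + j - 1 by omega]

theorem bracket_mono (x y : Gen) :
    bracket (mono x : B1 K) (mono y) = (brCoeff x y : K) • mono (br x y) := by
  have h := fun i j => derivative_monomial_mul (K := K) i j
  have h' : ∀ i j : ℕ, PowerSeries.monomial i (1 : K) *
      PowerSeries.derivative K (PowerSeries.monomial j (1 : K)) =
        (j : K) • PowerSeries.monomial (i + j - 1) (1 : K) := fun i j => by
    rw [mul_comm, h, add_comm]
  rcases x with i | i <;> rcases y with j | j <;> ext1 <;>
    simp [bracket_fst, bracket_snd, mono, br, brCoeff, h, h', sub_smul]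

/-- The derivative costs one Taylor coefficient. -/
theorem agree_bracket {N : ℕ} {f f' g g' : B1 K} (hf : Agree (N + 1) f f')
    (hg : Agree (N + 1) g g') : Agree N (bracket f g) (bracket f' g') := by
  have key : ∀ p p' q q' : PowerSeries K,
      (∀ n < N + 1, PowerSeries.coeff n p = PowerSeries.coeff n p') →
      (∀ n < N + 1, PowerSeries.coeff n q = PowerSeries.coeff n q') → ∀ n < N,
      PowerSeries.coeff n (PowerSeries.derivative K p * q) =
        PowerSeries.coeff n (PowerSeries.derivative K p' * q') := by
    intro p p' q q' hp hq n hn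
    rw [PowerSeries.coeff_mul, PowerSeries.coeff_mul]
    refine Finset.sum_congr rfl fun ij hij => ?_
    have := Finset.HasAntidiagonal.mem_antidiagonal.1 hij
    rw [PowerSeries.coeff_derivative, PowerSeries.coeff_derivative, hp _ (by omega),
      hq _ (by omega)]
  intro n hn
  simp only [bracket_fst, bracket_snd, map_sub]
  constructor
  · rw [key _ _ _ _ (fun n hn => (hf n hn).1) (fun n hn => (hg n hn).2) n hn, mul_comm f.snd,
      mul_comm f'.snd, key _ _ _ _ (fun n hn => (hg n hn).1) (fun n hn => (hf n hn).2) n hn]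
  · rw [key _ _ _ _ (fun n hn => (hf n hn).2) (fun n hn => (hg n hn).2) n hn, mul_comm f.snd,
      mul_comm f'.snd, key _ _ _ _ (fun n hn => (hg n hn).2) (fun n hn => (hf n hn).2) n hn]

variable (K) in
noncomputable def superSignLin : B1 K →ₗ[K] B1 K := evenLin K - oddLin K

theorem Agree.superSign {N : ℕ} {f g : B1 K} (h : Agree N f g) :
    Agree N (superSign f) (superSign g) := fun n hn => by
  simpa [Buttin.superSign, Buttin.evenPart, Buttin.oddPart] using h n hn

theorem superSign_mono_E (i : ℕ) : superSign (mono (E i) : B1 K) = mono (E i) := by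
  rw [superSign, evenPart_mono_E, oddPart_mono_E, sub_zero]

theorem superSign_mono_O (i : ℕ) : superSign (mono (O i) : B1 K) = -mono (O i) := by
  rw [superSign, evenPart_mono_O, oddPart_mono_O, zero_sub]

theorem agree_twist {k N : ℕ} (P : Fin k → Prop) [DecidablePred P] {a b : Fin k → B1 K}
    (h : ∀ i, Agree N (a i) (b i)) (i : Fin k) : Agree N (twist P a i) (twist P b i) := by
  simp only [twist]
  split_ifs
  · exact (h i).superSign
  · exact h i

theorem agree_update {k N : ℕ} {x y : B1 K} {a b : Fin k → B1 K} (i : Fin k) (h : Agree N x y)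
    (hab : ∀ i, Agree N (a i) (b i)) (l : Fin k) :
    Agree N (Function.update a i x l) (Function.update b i y l) := by
  by_cases hl : l = i
  · subst hl; simpa using h
  · simpa [hl] using hab l

theorem differential_term_mem_forms {k : ℕ} {C : (Fin k → B1 K) → K} (hC : C ∈ forms K k)
    (P : Fin (k + 1) → Prop) [DecidablePred P] (π : B1 K →ₗ[K] B1 K)
    (hπ : ∀ N f g, Agree N f g → Agree N (π f) (π g)) {i j : Fin (k + 1)} (hij : i ≠ j) :
    (fun a : Fin (k + 1) → B1 K =>
      C (j.removeNth (Function.update (twist P a) i (bracket (a i) (π (a j)))))) ∈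
        forms K (k + 1) := by
  obtain ⟨⟨M, hM⟩, N, hN⟩ := hC
  obtain ⟨i, rfl⟩ := Fin.exists_succAbove_eq hij
  set τ : Fin k → B1 K →ₗ[K] B1 K := fun l =>
    if P (j.succAbove l) then superSignLin K else LinearMap.id with hτ
  have hupd : ∀ (S : B1 K →ₗ[K] B1 K) (m : Fin k → B1 K),
      (fun l => Function.update τ i S l (m l)) =
        Function.update (fun l => τ l (m l)) i (S (m i)) := by
    intro S m
    funext l
    by_cases hl : l = i
    · subst hl; simp
    · simp [hl]
  -- The argument at `j` enters only through the bracket, so the term is a linear map from it to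
  -- multilinear forms in the remaining arguments, uncurried at position `j`.
  let F : B1 K →ₗ[K] MultilinearMap K (fun _ : Fin k => B1 K) K :=
    { toFun := fun y => M.compLinearMap (Function.update τ i ((bracketLin K).flip (π y)))
      map_add' := fun y y' => by
        ext m
        simp only [MultilinearMap.compLinearMap_apply, hupd, map_add, LinearMap.add_apply,
          M.map_update_add, add_apply]
      map_smul' := fun t y => by
        ext m
        simp only [MultilinearMap.compLinearMap_apply, hupd, map_smul, LinearMap.smul_apply,
          M.map_update_smul, smul_apply, RingHom.id_apply] }
  refine ⟨⟨F.uncurryMid j, fun a => ?_⟩, N + 1, fun a b hab => ?_⟩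
  · rw [LinearMap.uncurryMid_apply]
    show M.compLinearMap _ _ = C _
    rw [Fin.removeNth_update_succAbove, ← hM]
    rw [MultilinearMap.compLinearMap_apply, hupd]
    congr 2
    funext l
    simp only [hτ, Fin.removeNth, twist]
    split_ifs <;> rfl
  · have hab' : ∀ l, Agree N (a l) (b l) := fun l => Agree.mono N.le_succ (hab l)
    exact hN _ _ fun l => agree_update _ (agree_bracket (hab _) (hπ _ _ _ (hab _)))
      (agree_twist P hab') _

/-- Gives the even and the odd summands a common shape, so that one membership lemma covers both. -/
theorem twist_false {k : ℕ} (a : Fin k → B1 K) : twist (fun _ => False) a = a := by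
  funext l; simp [twist]

theorem differential_mem_forms {k : ℕ} {C : (Fin k → B1 K) → K} (hC : C ∈ forms K k) :
    differential K k C ∈ forms K (k + 1) := by
  have e : differential K k C = ∑ j : Fin (k + 1), ∑ i ∈ Finset.univ.filter (fun i => i < j),
      (-1 : K) ^ (j : ℕ) • ((fun a => C (j.removeNth (Function.update (twist (fun _ => False) a) i
          (bracket (a i) (evenLin K (a j)))))) +
        fun a => C (j.removeNth (Function.update (twist (fun l => i < l ∧ l < j) a) i
          (bracket (a i) (oddLin K (a j)))))) := by
    funext a
    simp only [Finset.sum_apply, twist_false]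
    rfl
  rw [e]
  refine Submodule.sum_mem _ fun j _ => Submodule.sum_mem _ fun i hi => Submodule.smul_mem _ _
    (Submodule.add_mem _ ?_ ?_)
  · exact differential_term_mem_forms hC _ _ (fun _ _ _ h => h.evenPart)
      (Finset.mem_filter.1 hi).2.ne
  · exact differential_term_mem_forms hC _ _ (fun _ _ _ h => h.oddPart)
      (Finset.mem_filter.1 hi).2.ne

theorem wedge_mem_forms {k : ℕ} {C : (Fin k → B1 K) → K} (hC : C ∈ forms K k)
    (φ : B1 K →ₗ[K] K) {N : ℕ} (hφ : ∀ x y, Agree N x y → φ x = φ y) :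
    wedge C φ ∈ forms K (k + 1) := by
  have key : ∀ (j : Fin (k + 1)) (P : Fin (k + 1) → Prop) [DecidablePred P] (π : B1 K →ₗ[K] B1 K),
      (∀ N f g, Agree N f g → Agree N (π f) (π g)) →
      (fun a : Fin (k + 1) → B1 K => C (j.removeNth (twist P a)) * φ (π (a j))) ∈
        forms K (k + 1) := by
    intro j P _ π hπ
    obtain ⟨⟨M, hM⟩, N', hN'⟩ := hC
    refine ⟨⟨((φ.comp π).smulRight (M.compLinearMap fun l =>
      if P (j.succAbove l) then superSignLin K else LinearMap.id)).uncurryMid j, fun a => ?_⟩,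
      max N N', fun a b hab => ?_⟩
    · rw [LinearMap.uncurryMid_apply, LinearMap.smulRight_apply, smul_apply, smul_eq_mul, mul_comm,
        MultilinearMap.compLinearMap_apply, hM]
      refine congrArg₂ (· * ·) (congrArg C ?_) rfl
      funext l
      simp only [Fin.removeNth, twist]
      split_ifs <;> rfl
    · have h1 := hφ _ _ (hπ _ _ _ (Agree.mono (le_max_left N N') (hab j)))
      have h2 := hN' _ _ fun l => agree_twist P
        (fun i => Agree.mono (le_max_right N N') (hab i)) (j.succAbove l)
      simp only [h1]
      congr 1
  have e : wedge C φ = ∑ j : Fin (k + 1), (-1 : K) ^ (k - (j : ℕ)) •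
      ((fun a => C (j.removeNth (twist (fun _ => False) a)) * φ (evenLin K (a j))) +
        fun a => C (j.removeNth (twist (fun l => j < l) a)) * φ (oddLin K (a j))) := by
    funext a
    simp only [Finset.sum_apply, twist_false]
    rfl
  rw [e]
  exact Submodule.sum_mem _ fun j _ => Submodule.smul_mem _ _ (Submodule.add_mem _
    (key j _ _ fun _ _ _ h => h.evenPart) (key j _ _ fun _ _ _ h => h.oddPart))

end Bracket

/-! ### Differential and wedge translated to lists -/

section Recursion
variable {K : Type*} [Field K]

theorem twist_cons_of_not {k : ℕ} (P : Fin (k + 1) → Prop) [DecidablePred P] (Q : Fin k → Prop)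
    [DecidablePred Q] (h0 : ¬P 0) (h : ∀ l : Fin k, P l.succ ↔ Q l) (x : B1 K) (a : Fin k → B1 K) :
    twist P (Fin.cons x a : Fin (k + 1) → B1 K) = Fin.cons x (twist Q a) := by
  funext l
  cases l using Fin.cases with
  | zero => simp [twist, h0]
  | succ l => simp [twist, h]

theorem twist_cons_of_pos {k : ℕ} (P : Fin (k + 1) → Prop) [DecidablePred P] (Q : Fin k → Prop)
    [DecidablePred Q] (h0 : P 0) (h : ∀ l : Fin k, P l.succ ↔ Q l) (x : B1 K) (a : Fin k → B1 K) :
    twist P (Fin.cons x a : Fin (k + 1) → B1 K) = Fin.cons (superSign x) (twist Q a) := by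
  funext l
  cases l using Fin.cases with
  | zero => simp [twist, h0]
  | succ l => simp [twist, h]

theorem removeNth_succ_cons {k : ℕ} (j : Fin (k + 1)) (x : B1 K) (a : Fin (k + 1) → B1 K) :
    j.succ.removeNth (Fin.cons x a : Fin (k + 2) → B1 K) = Fin.cons x (j.removeNth a) :=
  Fin.cons_comp_succ_succAbove x a j

theorem removeNth_zero_cons {k : ℕ} (x : B1 K) (a : Fin k → B1 K) :
    (0 : Fin (k + 1)).removeNth (Fin.cons x a : Fin (k + 1) → B1 K) = a := by
  rw [Fin.removeNth_zero, Fin.tail_cons]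

/-- The terms of the differential which contain the bracket with the first argument `x`. -/
noncomputable def headTerm {k : ℕ} (C : (Fin (k + 1) → B1 K) → K) (x : B1 K) :
    (Fin (k + 1) → B1 K) → K :=
  fun a => ∑ j : Fin (k + 1), (-1) ^ ((j : ℕ) + 1) *
    (C (Fin.cons (bracket x (evenPart (a j))) (j.removeNth a)) +
      C (Fin.cons (bracket x (oddPart (a j))) (j.removeNth (twist (fun l => l < j) a))))

/-- Cartan's formula at the level of forms: the terms with `i = 0` give `headTerm`, and in the
others the omitted index `j` shifts by one, which produces the minus sign. -/
theorem insertHead_differential {k : ℕ} (C : (Fin (k + 1) → B1 K) → K) (x : B1 K) :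
    insertHead x (differential K (k + 1) C) =
      headTerm C x - differential K k (insertHead x C) := by
  funext a
  rw [insertHead_apply, Pi.sub_apply]
  simp only [differential, LinearMap.coe_mk, AddHom.coe_mk, Finset.sum_filter]
  rw [Fin.sum_univ_succ]
  simp only [Fin.not_lt_zero, if_false, Finset.sum_const_zero, zero_add]
  rw [headTerm, ← Finset.sum_sub_distrib]
  refine Finset.sum_congr rfl fun j _ => ?_
  rw [Fin.sum_univ_succ, sub_eq_add_neg, ← Finset.sum_neg_distrib]
  congr 1
  · rw [if_pos (Fin.succ_pos j), twist_cons_of_not _ (fun l => l < j) (by simp) (by simp)]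
    simp only [Fin.cons_zero, Fin.cons_succ, Fin.update_cons_zero, removeNth_succ_cons,
      Fin.val_succ]
  · refine Finset.sum_congr rfl fun i _ => ?_
    simp only [Fin.succ_lt_succ_iff]
    split_ifs with h
    · rw [twist_cons_of_not _ (fun l => i < l ∧ l < j) (by simp) (by simp)]
      simp only [Fin.cons_succ, ← Fin.cons_update, removeNth_succ_cons, insertHead_apply,
        Fin.val_succ]
      ring
    · simp

theorem differential_zero (C : (Fin 0 → B1 K) → K) : differential K 0 C = 0 := by
  funext a
  simp only [differential, LinearMap.coe_mk, AddHom.coe_mk]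
  refine Finset.sum_eq_zero fun j _ => ?_
  rw [Finset.filter_false_of_mem (fun i _ => by omega), Finset.sum_empty]

theorem insertHead_smul {k : ℕ} {C : (Fin (k + 1) → B1 K) → K} (hC : C ∈ forms K (k + 1)) (t : K)
    (x : B1 K) : insertHead (t • x) C = t • insertHead x C := by
  obtain ⟨⟨M, hM⟩, -⟩ := hC
  funext a
  simp only [insertHead_apply, Pi.smul_apply, ← hM]
  exact M.cons_smul a t x

theorem insertHead_neg {k : ℕ} {C : (Fin (k + 1) → B1 K) → K} (hC : C ∈ forms K (k + 1))
    (x : B1 K) : insertHead (-x) C = -insertHead x C := by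
  rw [← neg_one_smul K x, insertHead_smul hC, neg_one_smul]

theorem insertHead_zero {k : ℕ} {C : (Fin (k + 1) → B1 K) → K} (hC : C ∈ forms K (k + 1)) :
    insertHead 0 C = 0 := by
  rw [← zero_smul K (0 : B1 K), insertHead_smul hC, zero_smul]

theorem bracket_zero (f : B1 K) : bracket f 0 = 0 := (bracketLin K f).map_zero

theorem headTerm_first {k : ℕ} {C : (Fin (k + 1) → B1 K) → K} (hC : C ∈ forms K (k + 1))
    (x : B1 K) (y : Gen) (r : Fin k → B1 K) :
    C (Fin.cons (bracket x (evenPart (mono y))) r) + C (Fin.cons (bracket x (oddPart (mono y))) r) =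
      C (Fin.cons (bracket x (mono y)) r) := by
  have h0 : C (Fin.cons 0 r) = 0 := congrFun (insertHead_zero hC) r
  rcases y with i | i
  · rw [evenPart_mono_E, oddPart_mono_E, bracket_zero, h0, add_zero]
  · rw [evenPart_mono_O, oddPart_mono_O, bracket_zero, h0, zero_add]

theorem insertHead_headTerm_zero {C : (Fin 1 → B1 K) → K} (hC : C ∈ forms K 1) (x : B1 K)
    (y : Gen) : insertHead (mono y) (headTerm C x) = -insertHead (bracket x (mono y)) C := by
  funext a
  simp only [insertHead_apply, headTerm, Pi.neg_apply]
  rw [Fin.sum_univ_one, twist_cons_of_not _ (fun _ => False) (by simp) (by simp), twist_false]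
  simp only [removeNth_zero_cons, Fin.cons_zero]
  rw [headTerm_first hC]
  simp

/-- Matches the recursion of `listLie`. In the terms where a later argument is bracketed with `x`,
that bracket is moved past `y`; the sign of the swap and the twist of `y` by an odd argument combine
to `koszul x y`. -/
theorem insertHead_headTerm {k : ℕ} {C : (Fin (k + 2) → B1 K) → K}
    (hC : C ∈ cochains K (k + 2)) (x y : Gen) :
    insertHead (mono y) (headTerm C (mono x)) = -insertHead (bracket (mono x) (mono y)) C +
      (koszul x y : K) • headTerm (insertHead (mono y) C) (mono x) := by
  obtain ⟨hf, hs⟩ := mem_cochains.1 hC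
  funext a
  simp only [insertHead_apply, headTerm, Pi.neg_apply, Pi.add_apply, Pi.smul_apply, smul_eq_mul]
  rw [Fin.sum_univ_succ]
  congr 1
  · rw [twist_cons_of_not _ (fun _ => False) (by simp) (by simp), twist_false]
    simp only [removeNth_zero_cons, Fin.cons_zero]
    rw [headTerm_first hf]
    simp
  · rw [Finset.mul_sum]
    refine Finset.sum_congr rfl fun j _ => ?_
    rw [twist_cons_of_pos _ (fun l => l < j) (Fin.succ_pos j) (by simp)]
    simp only [removeNth_succ_cons, Fin.cons_succ, Fin.val_succ]
    have hneg : ∀ (u v : B1 K) (r : Fin k → B1 K),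
        C (Fin.cons u (Fin.cons (-v) r : Fin (k + 1) → B1 K)) =
          -C (Fin.cons u (Fin.cons v r : Fin (k + 1) → B1 K)) := fun u v r =>
      congrFun (insertHead_neg (insertHead_mem_forms hf u) v) r
    -- The parity of the bracket decides which rule of `swap_head` applies when it passes `y`.
    have hev : ∀ i (f : B1 K), IsEven (bracket (mono (E i)) (evenPart f)) := fun i f => by
      simp [IsEven, bracket_fst, mono, evenPart]
    have hod : ∀ i (f : B1 K), IsOdd (bracket (mono (E i)) (oddPart f)) := fun i f => by
      simp [IsOdd, bracket_snd, oddPart]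
    have hev' : ∀ i (f : B1 K), IsOdd (bracket (mono (O i)) (evenPart f)) := fun i f => by
      simp [IsOdd, bracket_snd, mono]
    have hod' : ∀ i (f : B1 K), IsEven (bracket (mono (O i)) (oddPart f)) := fun i f => by
      simp [IsEven, bracket_fst, mono, oddPart]
    have hsw := fun u v r => hs.swap_head u v r
    rcases y with i' | i'
    · rw [superSign_mono_E, (hsw (mono (E i')) _ _).2 (Or.inl rfl),
        (hsw (mono (E i')) _ _).2 (Or.inl rfl)]
      cases x <;> simp only [koszul] <;> ring
    · rw [superSign_mono_O, hneg]
      rcases x with i | i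
      · rw [(hsw (mono (O i')) _ _).2 (Or.inr (hev _ _)), (hsw (mono (O i')) _ _).1 rfl (hod _ _)]
        simp only [koszul]; ring
      · rw [(hsw (mono (O i')) _ _).1 rfl (hev' _ _), (hsw (mono (O i')) _ _).2 (Or.inr (hod' _ _))]
        simp only [koszul]; ring

theorem evalList_headTerm {k : ℕ} {C : (Fin (k + 1) → B1 K) → K} (hC : C ∈ cochains K (k + 1))
    (x : Gen) (l : List Gen) (hl : l.length = k + 1) :
    evalList (k + 1) l (headTerm C (mono x)) = listLie x l (fun t => evalList (k + 1) t C) := by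
  induction l generalizing k with
  | nil => simp at hl
  | cons y r ih =>
    have hf := (mem_cochains.1 hC).1
    rw [evalList_cons, listLie, evalList_cons]
    cases k with
    | zero =>
      obtain rfl : r = [] := by simpa using hl
      rw [insertHead_headTerm_zero hf, bracket_mono, insertHead_smul hf, map_neg, map_smul]
      simp [listLie]
    | succ k =>
      rw [insertHead_headTerm hC, bracket_mono, insertHead_smul hf, map_add, map_neg, map_smul,
        map_smul, ih (insertHead_mem_cochains hC _) (by simpa using hl)]
      rfl

theorem evalList_differential {k : ℕ} {C : (Fin k → B1 K) → K} (hC : C ∈ cochains K k)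
    (l : List Gen) (hl : l.length = k + 1) :
    evalList (k + 1) l (differential K k C) = listDiff l (fun t => evalList k t C) := by
  induction l generalizing k with
  | nil => simp at hl
  | cons x r ih =>
    cases k with
    | zero =>
      obtain rfl : r = [] := by simpa using hl
      rw [differential_zero, map_zero]
      simp [listDiff, listLie]
    | succ k =>
      rw [evalList_cons, insertHead_differential, map_sub,
        evalList_headTerm hC x r (by simpa using hl), ih (insertHead_mem_cochains hC _)
        (by simpa using hl)]
      rfl

/-- Application of the parity automorphism to all arguments. -/
noncomputable def signTwist {k : ℕ} (C : (Fin k → B1 K) → K) : (Fin k → B1 K) → K :=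
  fun a => C fun i => superSign (a i)

/-- Both signs count the odd entries of the list; `passSign (O i)` has one more factor -1 per entry,
whence `(-1) ^ k`. -/
theorem evalList_signTwist {k : ℕ} {C : (Fin k → B1 K) → K} (hC : C ∈ forms K k) (i : ℕ)
    (l : List Gen) (hl : l.length = k) :
    (-1) ^ k * evalList k l (signTwist C) = passSign (O i) l * evalList k l C := by
  induction l generalizing k with
  | nil =>
    obtain rfl : k = 0 := hl.symm
    have : signTwist C = C := by
      funext a
      exact congrArg C (Subsingleton.elim _ _)
    simp [this, passSign]
  | cons y r ih =>
    cases k with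
    | zero => simp at hl
    | succ k =>
      have e : insertHead (mono y) (signTwist C) = signTwist (insertHead (superSign (mono y)) C) := by
        funext a
        simp only [insertHead_apply, signTwist]
        congr 1
        funext l
        cases l using Fin.cases <;> rfl
      have h := ih (insertHead_mem_forms hC (mono y)) (by simpa using hl)
      rw [evalList_cons, evalList_cons, e]
      rcases y with j | j
      · rw [superSign_mono_E]
        simp only [passSign, koszul]
        linear_combination -h
      · have e2 : signTwist (-insertHead (mono (O j)) C) = -signTwist (insertHead (mono (O j)) C) :=
          rfl
        rw [superSign_mono_O, insertHead_neg hC, e2, map_neg]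
        simp only [passSign, koszul]
        linear_combination h

theorem passSign_E (i : ℕ) (l : List Gen) : (passSign (E i) l : K) = (-1) ^ l.length := by
  induction l with
  | nil => simp [passSign]
  | cons y r ih =>
    rw [passSign, ih, List.length_cons, pow_succ]
    cases y <;> simp [koszul]

theorem removeNth_zero_twist {k : ℕ} (x : B1 K) (a : Fin k → B1 K) :
    (0 : Fin (k + 1)).removeNth (twist (fun l => 0 < l) (Fin.cons x a : Fin (k + 1) → B1 K)) =
      fun i => superSign (a i) := by
  funext l
  simp [Fin.tail, twist]

theorem insertHead_wedge_zero (C : (Fin 0 → B1 K) → K) (φ : B1 K → K) (x : B1 K) :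
    insertHead x (wedge C φ) = φ (evenPart x) • C + φ (oddPart x) • signTwist C := by
  funext a
  simp only [insertHead_apply, wedge, Pi.add_apply, Pi.smul_apply, smul_eq_mul, signTwist]
  rw [Fin.sum_univ_one, removeNth_zero_twist, removeNth_zero_cons]
  simp only [Fin.cons_zero]
  simp
  ring

theorem insertHead_wedge {k : ℕ} (C : (Fin (k + 1) → B1 K) → K) (φ : B1 K → K) (x : B1 K) :
    insertHead x (wedge C φ) = wedge (insertHead x C) φ +
      (-1 : K) ^ (k + 1) • (φ (evenPart x) • C + φ (oddPart x) • signTwist C) := by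
  funext a
  simp only [insertHead_apply, wedge, Pi.add_apply, Pi.smul_apply, smul_eq_mul, signTwist]
  rw [Fin.sum_univ_succ, removeNth_zero_twist, removeNth_zero_cons, add_comm]
  congr 1
  · refine Finset.sum_congr rfl fun j _ => ?_
    rw [twist_cons_of_not _ (fun l => j < l) (by simp) (by simp)]
    simp only [removeNth_succ_cons, Fin.cons_succ, Fin.val_succ, Nat.add_sub_add_right]
  · simp only [Fin.cons_zero, Fin.val_zero, Nat.sub_zero]
    ring

/-- Either the 1-cochain takes a later argument, or it takes the first one, which must then be moved
past all the others; this is the recursion of `listWedge`. -/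
theorem evalList_wedge {k : ℕ} {C : (Fin k → B1 K) → K} (hC : C ∈ forms K k) (φ : B1 K →ₗ[K] K)
    (l : List Gen) (hl : l.length = k + 1) :
    evalList (k + 1) l (wedge C φ) =
      listWedge (fun z => φ (mono z)) l (fun t => evalList k t C) := by
  have key : ∀ (m : ℕ) (D : (Fin m → B1 K) → K), D ∈ forms K m → ∀ (x : Gen) (r : List Gen),
      r.length = m → evalList m r ((-1 : K) ^ m • (φ (evenPart (mono x)) • D +
        φ (oddPart (mono x)) • signTwist D)) = φ (mono x) * passSign x r * evalList m r D := by
    intro m D hD x r hr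
    simp only [map_smul, map_add, smul_eq_mul]
    rcases x with i | i
    · rw [evenPart_mono_E, oddPart_mono_E, map_zero, passSign_E, hr]
      ring
    · rw [evenPart_mono_O, oddPart_mono_O, map_zero]
      linear_combination φ (mono (O i)) * evalList_signTwist hD i r hr
  induction l generalizing k with
  | nil => simp at hl
  | cons x r ih =>
    cases k with
    | zero =>
      obtain rfl : r = [] := by simpa using hl
      rw [evalList_cons, insertHead_wedge_zero]
      have h := key 0 C hC x [] rfl
      rw [pow_zero, one_smul] at h
      rw [h]
      simp [listWedge]
    | succ k =>
      rw [evalList_cons, insertHead_wedge, map_add, key _ C hC x r (by simpa using hl),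
        ih (insertHead_mem_forms hC _) (by simpa using hl)]
      rfl

theorem wedge_mem_cochains {k : ℕ} {C : (Fin k → B1 K) → K} (hC : C ∈ cochains K k)
    (φ : B1 K →ₗ[K] K) {N : ℕ} (hφ : ∀ x y, Agree N x y → φ x = φ y) :
    wedge C φ ∈ cochains K (k + 1) := by
  obtain ⟨hf, hs⟩ := mem_cochains.1 hC
  refine mem_cochains.2 ⟨wedge_mem_forms hf φ hφ,
    isSuperSkew_of_listSkew (wedge_mem_forms hf φ hφ) fun l x y r => ?_⟩
  simp only
  by_cases hl : (l ++ x :: y :: r).length = k + 1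
  · rw [evalList_wedge hf φ _ hl, evalList_wedge hf φ _ (by simpa using hl)]
    exact hs.listSkew.listWedge _ l x y r
  · rw [evalList_of_length_ne hl, evalList_of_length_ne (by simpa using hl), mul_zero]

end Recursion

/-! ### Values of exterior products on monomials -/

section Wedges
variable {K : Type*} [Field K]

theorem coeffGen_mono_eq_zero (y z : Gen) (h : z.weight ≠ y.weight) :
    coeffGen K y (mono z) = 0 := by
  classical
  rw [coeffGen_mono, if_neg]
  rintro rfl
  exact h rfl

theorem wedge_coeffGen_mem {k : ℕ} {C : (Fin k → B1 K) → K} (hC : C ∈ cochains K k) (y : Gen) :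
    wedge C (coeffGen K y) ∈ cochains K (k + 1) :=
  wedge_mem_cochains hC _ (coeffGen_agree y)

theorem evalList_wedge_eq_zero {k : ℕ} {C : (Fin k → B1 K) → K} (hC : C ∈ cochains K k) {w : ℤ}
    (hw : ∀ l, listWeight l ≠ w → evalList k l C = 0) (y : Gen) (l : List Gen)
    (hl : listWeight l ≠ w + y.weight) : evalList (k + 1) l (wedge C (coeffGen K y)) = 0 := by
  by_cases h : l.length = k + 1
  · rw [evalList_wedge (mem_cochains.1 hC).1 _ l h]
    exact listWedge_eq_zero (fun z hz => coeffGen_mono_eq_zero y z hz) hw l hl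
  · exact evalList_of_length_ne h _

theorem unitCochain_mem : (unitCochain : (Fin 0 → B1 K) → K) ∈ cochains K 0 :=
  ⟨⟨MultilinearMap.constOfIsEmpty K _ 1, fun _ => rfl⟩, fun _ i => i.elim0, 0, fun _ _ _ => rfl⟩

theorem evalList_unitCochain (l : List Gen) (hl : listWeight l ≠ 0) :
    evalList 0 l (unitCochain : (Fin 0 → B1 K) → K) = 0 := by
  cases l with
  | nil => simp at hl
  | cons x l => rfl

theorem evalList_wedge_unit (φ : B1 K →ₗ[K] K) (x : Gen) :
    evalList 1 [x] (wedge unitCochain φ) = φ (mono x) := by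
  rw [evalList_wedge (mem_cochains.1 unitCochain_mem).1 φ [x] rfl]
  simp [listWedge, passSign, evalList, unitCochain]

theorem evalList_wedge₂ (p q x y : Gen) :
    evalList 2 [x, y] (wedge (wedge unitCochain (coeffGen K p)) (coeffGen K q)) =
      coeffGen K p (mono x) * coeffGen K q (mono y) -
        koszul x y * (coeffGen K p (mono y) * coeffGen K q (mono x)) := by
  rw [evalList_wedge (mem_cochains.1 (wedge_coeffGen_mem unitCochain_mem p)).1 _ _ rfl]
  have e : ∀ z, evalList (0 + 1) [z] (wedge unitCochain (coeffGen K p)) = coeffGen K p (mono z) :=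
    evalList_wedge_unit _
  simp only [listWedge, passSign, e]
  ring

theorem wedge₃_mem (p q r : Gen) :
    wedge₃ (coeffGen K p) (coeffGen K q) (coeffGen K r) ∈ cochains K 3 :=
  wedge_coeffGen_mem (wedge_coeffGen_mem (wedge_coeffGen_mem unitCochain_mem p) q) r

theorem evalList_wedge₃ (p q r x y z : Gen) :
    evalList 3 [x, y, z] (wedge₃ (coeffGen K p) (coeffGen K q) (coeffGen K r)) =
      (coeffGen K p (mono x) * coeffGen K q (mono y) -
        koszul x y * (coeffGen K p (mono y) * coeffGen K q (mono x))) * coeffGen K r (mono z) -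
      koszul y z * ((coeffGen K p (mono x) * coeffGen K q (mono z) -
        koszul x z * (coeffGen K p (mono z) * coeffGen K q (mono x))) * coeffGen K r (mono y)) +
      koszul x y * koszul x z * ((coeffGen K p (mono y) * coeffGen K q (mono z) -
        koszul y z * (coeffGen K p (mono z) * coeffGen K q (mono y))) *
          coeffGen K r (mono x)) := by
  rw [wedge₃, evalList_wedge (mem_cochains.1 (wedge_coeffGen_mem
    (wedge_coeffGen_mem unitCochain_mem p) q)).1 _ _ rfl]
  have e : ∀ s t, evalList (0 + 1 + 1) [s, t]
      (wedge (wedge unitCochain (coeffGen K p)) (coeffGen K q)) = _ := evalList_wedge₂ p q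
  simp only [listWedge, passSign, e]
  ring

theorem wedge₃_weight (p q r : Gen) (l : List Gen)
    (hl : listWeight l ≠ p.weight + q.weight + r.weight) :
    evalList 3 l (wedge₃ (coeffGen K p) (coeffGen K q) (coeffGen K r)) = 0 := by
  have h1 := evalList_wedge_eq_zero (K := K) unitCochain_mem evalList_unitCochain p
  have h2 := evalList_wedge_eq_zero (wedge_coeffGen_mem unitCochain_mem p) h1 q
  exact evalList_wedge_eq_zero (wedge_coeffGen_mem (wedge_coeffGen_mem unitCochain_mem p) q) h2 r l
    (by rwa [zero_add])

theorem wedgePow_mem {k : ℕ} {C : (Fin k → B1 K) → K} (hC : C ∈ cochains K k) (m : ℕ) :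
    wedgePow C (cO K 0) m ∈ cochains K (k + m) := by
  induction m with
  | zero => exact hC
  | succ m ih => exact wedge_coeffGen_mem ih (O 0)

theorem wedgePow_weightZero {k : ℕ} {C : (Fin k → B1 K) → K} (hC : C ∈ cochains K k)
    (hw : WeightZero (fun l => evalList k l C)) (m : ℕ) :
    WeightZero (fun l => evalList (k + m) l (wedgePow C (cO K 0) m)) := by
  induction m with
  | zero => exact hw
  | succ m ih =>
    exact fun l hl => evalList_wedge_eq_zero (wedgePow_mem hC m) ih (O 0) l (by simpa [weight])

theorem passSign_ones (n : ℕ) : (passSign (O 0) (ones n) : K) = 1 := by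
  induction n with
  | zero => rfl
  | succ n ih => rw [ones, List.replicate_succ, passSign, ih]; simp [koszul]

theorem listWedge_eq_zero_of_forall {φ : Gen → K} {l : List Gen} (h : ∀ x ∈ l, φ x = 0)
    (c : List Gen → K) : listWedge φ l c = 0 := by
  induction l generalizing c with
  | nil => rfl
  | cons x l ih => simp [listWedge, ih fun y hy => h y (by simp [hy]), h x (by simp)]

/-- Odd elements commute in the super sense, so the `n + 1` choices of a copy of `O 0` all
contribute with the same sign. -/
theorem listWedge_append_ones {φ : Gen → K} (hφ : φ (O 0) = 1) {p : List Gen}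
    (hp : ∀ x ∈ p, φ x = 0) (n : ℕ) (c : List Gen → K) :
    listWedge φ (p ++ ones (n + 1)) c = (n + 1) * c (p ++ ones n) := by
  induction p generalizing c with
  | nil =>
    induction n generalizing c with
    | zero => simp [listWedge, passSign, hφ]
    | succ n ih =>
      have h := ih (fun t => c (O 0 :: t))
      rw [List.nil_append] at h
      rw [List.nil_append, ones, List.replicate_succ, listWedge, h, passSign_ones, hφ]
      simp only [List.nil_append, List.replicate_succ]
      push_cast
      ring
  | cons x p ih =>
    rw [List.cons_append, listWedge, ih (fun y hy => hp y (by simp [hy])), hp x (by simp)]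
    simp

/-- Successive factors `C(1)` choose among `n`, `n - 1`, ... copies of `O 0`. For `n < m` the
falling factorial vanishes, so the truncation in `n - m` is harmless. -/
theorem evalList_wedgePow {k : ℕ} {C : (Fin k → B1 K) → K} (hC : C ∈ cochains K k) {p : List Gen}
    (hp : ∀ x ∈ p, cO K 0 (mono x) = 0) (m n : ℕ) :
    evalList (k + m) (p ++ ones n) (wedgePow C (cO K 0) m) =
      n.descFactorial m * evalList k (p ++ ones (n - m)) C := by
  induction m generalizing n with
  | zero => simp [wedgePow]
  | succ m ih =>
    have hf := (mem_cochains.1 (wedgePow_mem hC m)).1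
    by_cases hl : (p ++ ones n).length = k + m + 1
    · have e : evalList (k + (m + 1)) (p ++ ones n) (wedgePow C (cO K 0) (m + 1)) =
          listWedge (fun z => cO K 0 (mono z)) (p ++ ones n)
            fun t => evalList (k + m) t (wedgePow C (cO K 0) m) :=
        evalList_wedge hf (coeffGen K (O 0)) _ hl
      rw [e]
      cases n with
      | zero =>
        rw [ones, List.replicate_zero, List.append_nil, listWedge_eq_zero_of_forall hp]
        simp
      | succ n =>
        rw [listWedge_append_ones (by simpa using cO_mono_O (K := K) 0 0) hp, ih,
          Nat.succ_descFactorial_succ, Nat.add_sub_add_right]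
        push_cast
        ring
    · rw [evalList_of_length_ne (k := k + (m + 1)) hl]
      cases n with
      | zero => simp
      | succ n =>
        by_cases hmn : m ≤ n
        · rw [evalList_of_length_ne (k := k), mul_zero]
          simp only [List.length_append, List.length_replicate] at hl ⊢
          omega
        · rw [Nat.descFactorial_eq_zero_iff_lt.2 (by omega)]
          simp

/-- The two linear conditions which characterize the coboundaries among the cocycles. -/
def ClassVanishes {k : ℕ} (C : (Fin k → B1 K) → K) : Prop :=
  ∀ n, evalList k (E 0 :: E 1 :: E 2 :: ones n) C = 0 ∧
    2 * evalList k (E 0 :: E 1 :: O 1 :: ones n) C = evalList k (E 0 :: E 2 :: ones (n + 1)) C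

theorem evalList_wedgePow_three {C : (Fin 3 → B1 K) → K} (hC : C ∈ cochains K 3) (x y z : Gen)
    (h : ∀ t ∈ [x, y, z], cO K 0 (mono t) = 0) (m : ℕ) :
    evalList (3 + m) (x :: y :: z :: ones m) (wedgePow C (cO K 0) m) =
      m.factorial * evalList 3 [x, y, z] C := by
  have := evalList_wedgePow hC h m m
  rwa [Nat.descFactorial_self, Nat.sub_self] at this

/-- Here one of the `m + 1` copies of `O 0` remains for `C`, which gives `(m + 1)!` instead of `m!`.
This asymmetry is the source of the factor `m + 5` later. -/
theorem evalList_wedgePow_two {C : (Fin 3 → B1 K) → K} (hC : C ∈ cochains K 3) (x y : Gen)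
    (h : ∀ t ∈ [x, y], cO K 0 (mono t) = 0) (m : ℕ) :
    evalList (3 + m) (x :: y :: ones (m + 1)) (wedgePow C (cO K 0) m) =
      (m + 1).factorial * evalList 3 [x, y, O 0] C := by
  have := evalList_wedgePow hC h m (m + 1)
  rw [Nat.add_sub_cancel_left] at this
  rw [show (m + 1).factorial = (m + 1).descFactorial m by
    rw [← Nat.factorial_mul_descFactorial (Nat.le_succ m)]; simp]
  exact this

theorem evalList_a3 (x y z : Gen) : evalList 3 [x, y, z] (a3 K) =
    evalList 3 [x, y, z] (wedge₃ (coeffGen K (E 0)) (coeffGen K (E 1)) (coeffGen K (E 2))) := rfl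

theorem b3_eq : b3 K = wedge₃ (coeffGen K (E 0)) (coeffGen K (E 1)) (coeffGen K (O 1)) -
    (1 / 2 : K) • wedge₃ (coeffGen K (E 0)) (coeffGen K (E 2)) (coeffGen K (O 0)) := rfl

theorem a3_mem : a3 K ∈ cochains K 3 := wedge₃_mem (E 0) (E 1) (E 2)

theorem b3_mem : b3 K ∈ cochains K 3 :=
  Submodule.sub_mem _ (wedge₃_mem (E 0) (E 1) (O 1))
    (Submodule.smul_mem _ _ (wedge₃_mem (E 0) (E 2) (O 0)))

theorem a3_weightZero : WeightZero (fun l => evalList 3 l (a3 K)) :=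
  fun l hl => wedge₃_weight (E 0) (E 1) (E 2) l (by simpa [weight] using hl)

theorem b3_weightZero : WeightZero (fun l => evalList 3 l (b3 K)) := fun l hl => by
  simp only
  rw [b3_eq, map_sub, map_smul, wedge₃_weight _ _ _ l (by simpa [weight] using hl),
    wedge₃_weight _ _ _ l (by simpa [weight] using hl), smul_zero, sub_zero]

theorem a3_values : evalList 3 [O 0, O 0, O 0] (a3 K) = 0 ∧ evalList 3 [E 1, O 0, O 0] (a3 K) = 0 ∧
    evalList 3 [E 0, E 1, E 2] (a3 K) = 1 ∧ evalList 3 [E 0, E 1, O 1] (a3 K) = 0 ∧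
    evalList 3 [E 0, E 2, O 0] (a3 K) = 0 := by
  classical
  simp [evalList_a3, evalList_wedge₃, coeffGen_mono]

theorem b3_values : evalList 3 [O 0, O 0, O 0] (b3 K) = 0 ∧ evalList 3 [E 1, O 0, O 0] (b3 K) = 0 ∧
    evalList 3 [E 0, E 1, E 2] (b3 K) = 0 ∧ evalList 3 [E 0, E 1, O 1] (b3 K) = 1 ∧
    evalList 3 [E 0, E 2, O 0] (b3 K) = -(1 / 2) := by
  classical
  simp [b3_eq, evalList_wedge₃, coeffGen_mono]

theorem classVanishes_iff {m : ℕ} {C : (Fin (3 + m) → B1 K) → K} : ClassVanishes C ↔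
    evalList (3 + m) (E 0 :: E 1 :: E 2 :: ones m) C = 0 ∧
    2 * evalList (3 + m) (E 0 :: E 1 :: O 1 :: ones m) C =
      evalList (3 + m) (E 0 :: E 2 :: ones (m + 1)) C := by
  refine ⟨fun h => h m, fun h n => ?_⟩
  by_cases hn : n = m
  · rw [hn]; exact h
  · rw [evalList_of_length_ne (by simp; omega), evalList_of_length_ne (by simp; omega),
      evalList_of_length_ne (by simp; omega)]
    simp

theorem cohomologyClass_eq_zero_iff_mem {k : ℕ} {C : (Fin k → B1 K) → K}
    (hC : C ∈ cocycles K k) : cohomologyClass K C hC = 0 ↔ C ∈ coboundaries K k :=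
  Submodule.Quotient.mk_eq_zero _

end Wedges

/-! ### Coboundaries, cocycles and the detecting functionals -/

section CharZero
variable {K : Type*} [Field K] [CharZero K]

/-- The witness is `C(1)^k / k!`; characteristic 0 permits the division. -/
theorem exists_dual_ones (k : ℕ) : ∃ u : List Gen → K, ListSkew u ∧ ListFinite u ∧ WeightZero u ∧
    (∀ n, u (ones n) = if n = k then 1 else 0) ∧ ∀ n, u (E 1 :: ones n) = 0 := by
  have hm := wedgePow_mem (K := K) unitCochain_mem k
  have hs : ListSkew fun l => evalList (0 + k) l (wedgePow unitCochain (cO K 0) k) :=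
    (mem_cochains.1 hm).2.listSkew
  obtain ⟨N, hN⟩ := listFinite_evalList (mem_cochains.1 hm).1
  have hw := wedgePow_weightZero (K := K) unitCochain_mem evalList_unitCochain k
  refine ⟨fun l => (k.factorial : K)⁻¹ * evalList (0 + k) l (wedgePow unitCochain (cO K 0) k),
    hs.smul _, ⟨N, fun l z hz hzN => ?_⟩, fun l hl => ?_, fun n => ?_, fun n => ?_⟩
  · have := hN l z hz hzN
    simp only at this ⊢
    rw [this, mul_zero]
  · have := hw l hl
    simp only at this ⊢
    rw [this, mul_zero]
  · simp only
    split_ifs with h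
    · subst h
      have := evalList_wedgePow (K := K) unitCochain_mem (p := []) (by simp) n n
      rw [List.nil_append] at this
      rw [this, Nat.descFactorial_self, Nat.sub_self]
      have h0 : (n.factorial : K) ≠ 0 := Nat.cast_ne_zero.2 n.factorial_ne_zero
      simp [evalList, unitCochain, h0]
    · rw [evalList_of_length_ne (by simpa using h), mul_zero]
  · have := evalList_wedgePow (K := K) unitCochain_mem (p := [E 1]) (by simp [cO_mono_E]) k n
    rw [List.singleton_append] at this
    simp only
    rw [this]
    simp [evalList]

/-- The witness in degree `k + 1` is `C(xX) ∧ C(1)^k / k!`; in degree 0 no such list exists and the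
zero function serves. -/
theorem exists_dual_E1_ones (k : ℕ) : ∃ v : List Gen → K, ListSkew v ∧ ListFinite v ∧
    WeightZero v ∧ (∀ n, v (ones n) = 0) ∧ ∀ n, v (E 1 :: ones n) = if n + 1 = k then 1 else 0 := by
  cases k with
  | zero => exact ⟨fun _ => 0, fun _ _ _ _ => by simp, ⟨0, fun _ _ _ _ => rfl⟩, fun _ _ => rfl,
      fun _ => rfl, fun n => by simp⟩
  | succ k =>
    have h1 := wedge_coeffGen_mem (K := K) unitCochain_mem (E 1)
    have hm := wedgePow_mem h1 k
    have hs := (mem_cochains.1 hm).2.listSkew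
    obtain ⟨N, hN⟩ := listFinite_evalList (mem_cochains.1 hm).1
    have hw := wedgePow_weightZero h1
      (evalList_wedge_eq_zero (K := K) unitCochain_mem evalList_unitCochain (E 1)) k
    have hbase : ∀ n, evalList 1 (ones n) (wedge unitCochain (coeffGen K (E 1))) = 0 := by
      intro n
      by_cases h : n = 1
      · subst h
        exact (evalList_wedge_unit (coeffGen K (E 1)) (O 0)).trans (cE_mono_O 1 0)
      · exact evalList_of_length_ne (by simpa using h) _
    refine ⟨fun l => (k.factorial : K)⁻¹ *
      evalList (0 + 1 + k) l (wedgePow (wedge unitCochain (coeffGen K (E 1))) (cO K 0) k),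
      hs.smul _, ⟨N, fun l z hz hzN => ?_⟩, fun l hl => ?_, fun n => ?_, fun n => ?_⟩
    · have := hN l z hz hzN
      simp only at this ⊢
      rw [this, mul_zero]
    · have := hw l hl
      simp only at this ⊢
      rw [this, mul_zero]
    · have := evalList_wedgePow h1 (p := []) (by simp) k n
      rw [List.nil_append] at this
      simp only
      rw [this, List.nil_append, hbase, mul_zero, mul_zero]
    · have := evalList_wedgePow h1 (p := [E 1]) (by simp [cO_mono_E]) k n
      rw [List.singleton_append] at this
      simp only
      rw [this]
      split_ifs with h
      · obtain rfl : n = k := by omega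
        have e : evalList 1 [E 1] (wedge unitCochain (coeffGen K (E 1))) = 1 :=
          (evalList_wedge_unit (coeffGen K (E 1)) (E 1)).trans ((cE_mono_E 1 1).trans (if_pos rfl))
        have h0 : (n.factorial : K) ≠ 0 := Nat.cast_ne_zero.2 n.factorial_ne_zero
        rw [Nat.descFactorial_self, Nat.sub_self]
        simp only [List.singleton_append, ones, List.replicate_zero]
        rw [e]
        simp [h0]
      · by_cases hkn : k ≤ n
        · rw [evalList_of_length_ne (by simp; omega)]
          simp
        · rw [Nat.descFactorial_eq_zero_iff_lt.2 (by omega)]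
          simp

/-- For `C = dD` the first value vanishes, and both sides of the second condition equal twice `D` at
`E 1 :: ones (n + 1)`. -/
theorem classVanishes_of_mem_coboundaries {k : ℕ} {C : (Fin k → B1 K) → K}
    (hC : C ∈ coboundaries K k) : ClassVanishes C := by
  cases k with
  | zero => exact fun n => by simp [evalList]
  | succ k =>
    obtain ⟨D, hD, rfl⟩ := hC
    have hs := (mem_cochains.1 hD).2.listSkew
    have key : ∀ l : List Gen, l.length = k + 1 ∨ listDiff l (fun t => evalList k t D) = 0 →
        evalList (k + 1) l (differential K k D) = listDiff l (fun t => evalList k t D) := by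
      intro l hl
      by_cases h : l.length = k + 1
      · exact evalList_differential hD l h
      · rw [evalList_of_length_ne h, hl.resolve_left h]
    intro n
    by_cases h : n + 2 = k
    · rw [key _ (Or.inl (by simp; omega)), key _ (Or.inl (by simp; omega)),
        key _ (Or.inl (by simp; omega)), listDiff_E0_E1_E2 n hs, listDiff_E0_E1_O1,
        listDiff_E0_E2]
      exact ⟨rfl, rfl⟩
    · rw [evalList_of_length_ne (by simp; omega), evalList_of_length_ne (by simp; omega),
        evalList_of_length_ne (by simp; omega)]
      simp

/-- In nonzero weight the Euler homotopy supplies a primitive. In weight zero the primitive only has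
to reproduce the values on `E 0 O 1 1^n` and `E 0 E 2 1^n`, because the cocycle condition and
`ClassVanishes` control the other four families. -/
theorem mem_coboundaries_of_classVanishes {k : ℕ} {C : (Fin (k + 1) → B1 K) → K}
    (hC : C ∈ cocycles K (k + 1)) (hv : ClassVanishes C) : C ∈ coboundaries K (k + 1) := by
  obtain ⟨hC1, hC2⟩ := Submodule.mem_inf.1 hC
  obtain ⟨hf, hs⟩ := mem_cochains.1 hC1
  replace hs := hs.listSkew
  set c : List Gen → K := fun l => evalList (k + 1) l C with hc
  have hlen : ∀ l : List Gen, l.length ≠ k + 1 → c l = 0 := fun l hl => evalList_of_length_ne hl C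
  have hd : ∀ l : List Gen, l.length = k + 2 → listDiff l c = 0 := fun l hl => by
    rw [← evalList_differential hC1 l hl, LinearMap.mem_ker.1 hC2, map_zero]
  obtain ⟨u, hu1, ⟨Nu, hu2⟩, hu3, hu4, hu5⟩ := exists_dual_ones (K := K) k
  obtain ⟨v, hv1, ⟨Nv, hv2⟩, hv3, hv4, hv5⟩ := exists_dual_E1_ones (K := K) k
  -- The differentials of `u` and `v` take the values 1 and 2 on these lists, hence the
  -- coefficients. For `k = 0` the lists have the wrong length and `p`, `q` are 0.
  set p : K := c (E 0 :: O 1 :: ones (k - 1)) with hp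
  set q : K := c (E 0 :: E 2 :: ones (k - 1)) / 2 with hq
  have hpu : ∀ n, c (E 0 :: O 1 :: ones n) = p * u (ones (n + 1)) := by
    intro n
    rw [hu4]
    split_ifs with h
    · rw [hp, ← h]; simp
    · rw [hlen _ (by simpa using h), mul_zero]
  have hqv : ∀ n, c (E 0 :: E 2 :: ones n) = 2 * (q * v (E 1 :: ones n)) := by
    intro n
    rw [hv5]
    split_ifs with h
    · rw [hq, ← h]; simp; field_simp
    · rw [hlen _ (by simpa using h), mul_zero, mul_zero]
  -- In weight zero `0⁻¹ = 0` removes the homotopy term, and in nonzero weight `u` and `v` vanish,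
  -- so the two pieces of the primitive do not interfere.
  set f : List Gen → K := fun l => (((listWeight l : ℤ) : K)⁻¹ * c (E 1 :: l)) +
    (p * u l + q * v l) with hfdef
  have hfs : ListSkew f := ((hs.curry (E 1)).weight_mul fun w => (w : K)⁻¹).add
    ((hu1.smul p).add (hv1.smul q))
  have hff : ListFinite f := by
    obtain ⟨N, hN⟩ := listFinite_evalList hf
    refine ⟨max N (max Nu Nv), fun l z hz hzN => ?_⟩
    have h1 : c (E 1 :: l) = 0 := hN _ z (by simp [hz]) (by omega)
    simp only [hfdef, h1, hu2 l z hz (by omega), hv2 l z hz (by omega), mul_zero, add_zero]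
  have hdf : ∀ l, listDiff l f = ((listWeight l : ℤ) : K)⁻¹ * listDiff l (fun t => c (E 1 :: t)) +
      (p * listDiff l u + q * listDiff l v) := by
    intro l
    have h1 := listDiff_linear 1 1 (fun l => ((listWeight l : ℤ) : K)⁻¹ * c (E 1 :: l))
      (fun l => p * u l + q * v l) l
    simp only [one_mul] at h1
    rw [hfdef, h1, listDiff_linear, listDiff_weight_mul l (fun w => (w : K)⁻¹)]
  -- Cartan's formula for the cocycle `c` and the Euler element.
  have hE : ∀ l : List Gen, l.length = k + 1 →
      listDiff l (fun t => c (E 1 :: t)) = listWeight l * c l := by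
    intro l hl
    have := hd (E 1 :: l) (by simp [hl])
    rw [listDiff, listLie_euler] at this
    linear_combination -this
  -- The weight-zero part of `c - p du - q dv` is skew, so it suffices that it vanishes on the six
  -- families.
  have hzero : ∀ l, (if listWeight l = 0 then (1 : K) else 0) *
      (c l + (-p * listDiff l u + -q * listDiff l v)) = 0 := by
    refine ListSkew.eq_zero_of_canonical
      ((hs.add ((hu1.listDiff.smul (-p)).add (hv1.listDiff.smul (-q)))).weight_mul
        fun w => if w = 0 then 1 else 0) (fun l hl => by simp [hl]) ?_ ?_ ?_ ?_ ?_ ?_ <;> intro n <;>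
      refine mul_eq_zero_of_right _ ?_
    · rw [listDiff_ones, listDiff_ones]
      by_cases h : n = k + 1
      · have := hd (E 0 :: O 1 :: ones k) (by simp)
        rw [listDiff_E0_O1, ← h] at this
        simp [this]
      · simp [hlen (ones n) (by simpa using h)]
    · rw [listDiff_one, listDiff_one]
      by_cases h : n = k
      · have := hd (E 0 :: E 2 :: ones n) (by simp [h])
        rw [listDiff_E0_E2] at this
        simpa using this
      · simp [hlen (E 1 :: ones n) (by simpa using h)]
    · rw [listDiff_E0_E2, listDiff_E0_E2, hqv, hu5]
      ring
    · rw [listDiff_E0_O1, listDiff_E0_O1, hpu, hv4]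
      ring
    · rw [listDiff_E0_E1_E2 n hu1, listDiff_E0_E1_E2 n hv1]
      simpa using (hv n).1
    · rw [listDiff_E0_E1_O1, listDiff_E0_E1_O1, hu5]
      have h1 : 2 * c (E 0 :: E 1 :: O 1 :: ones n) = c (E 0 :: E 2 :: ones (n + 1)) := (hv n).2
      rw [hqv] at h1
      linear_combination h1 / 2
  obtain ⟨D, hD, hDf⟩ := exists_cochain hff hfs k
  refine ⟨D, hD, forms_ext (differential_mem_forms (mem_cochains.1 hD).1) hf fun l hl => ?_⟩
  -- `D` agrees with `f` only on lists of length `k`, and the differential at a list reads only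
  -- lists shorter by one.
  have hcongr : ∀ (l : List Gen) (g h : List Gen → K), (∀ t : List Gen, t.length + 1 = l.length →
      g t = h t) → listDiff l g = listDiff l h := by
    have hlie : ∀ (x : Gen) (l : List Gen) (g h : List Gen → K), (∀ t : List Gen,
        t.length = l.length → g t = h t) → listLie x l g = listLie x l h := by
      intro x l
      induction l with
      | nil => intros; rfl
      | cons y r ih =>
        intro g h hgh
        rw [listLie, listLie, hgh _ (by simp), ih _ _ fun t ht => hgh (y :: t) (by simp [ht])]
    intro l
    induction l with
    | nil => intros; rfl
    | cons y r ih =>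
      intro g h hgh
      rw [listDiff, listDiff, hlie y r g h fun t ht => hgh t (by simp [ht]),
        ih _ _ fun t ht => hgh (y :: t) (by simp [ht])]
  rw [evalList_differential hD l hl, hcongr l _ f fun t ht => hDf t (by omega), hdf, hE l hl]
  by_cases hw : listWeight l = 0
  · have := hzero l
    rw [if_pos hw, one_mul] at this
    rw [hw]
    simp only [Int.cast_zero, zero_mul, mul_zero]
    linear_combination -this
  · have hu0 : listDiff l u = 0 := hu3.listDiff l hw
    have hv0 : listDiff l v = 0 := hv3.listDiff l hw
    rw [hu0, hv0, inv_mul_cancel_left₀ (Int.cast_ne_zero.2 hw)]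
    simp [hc]

theorem mem_coboundaries_iff {k : ℕ} (hk : k ≠ 0) {C : (Fin k → B1 K) → K}
    (hC : C ∈ cocycles K k) : C ∈ coboundaries K k ↔ ClassVanishes C := by
  refine ⟨classVanishes_of_mem_coboundaries, fun hv => ?_⟩
  cases k with
  | zero => exact absurd rfl hk
  | succ k => exact mem_coboundaries_of_classVanishes hC hv

theorem mem_cocycles_of_weightZero {k : ℕ} {C : (Fin k → B1 K) → K} (hC : C ∈ cochains K k)
    (hw : WeightZero (fun l => evalList k l C)) (h1 : ∀ n, evalList k (ones (n + 1)) C = 0)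
    (h2 : ∀ n, evalList k (E 1 :: ones n) C = 0) : C ∈ cocycles K k := by
  obtain ⟨hf, hs⟩ := mem_cochains.1 hC
  refine Submodule.mem_inf.2 ⟨hC, LinearMap.mem_ker.2
    (forms_eq_zero (differential_mem_forms hf) fun l hl => ?_)⟩
  rw [evalList_differential hC l hl]
  exact hs.listSkew.listDiff_eq_zero hw h1 h2 l

theorem wedgePow_mem_cocycles {C : (Fin 3 → B1 K) → K} (hC : C ∈ cochains K 3)
    (hw : WeightZero (fun l => evalList 3 l C)) (h1 : evalList 3 [O 0, O 0, O 0] C = 0)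
    (h2 : evalList 3 [E 1, O 0, O 0] C = 0) (m : ℕ) :
    wedgePow C (cO K 0) m ∈ cocycles K (3 + m) := by
  refine mem_cocycles_of_weightZero (wedgePow_mem hC m) (wedgePow_weightZero hC hw m)
    (fun n => ?_) fun n => ?_
  · have := evalList_wedgePow hC (p := []) (by simp) m (n + 1)
    rw [List.nil_append, List.nil_append] at this
    rw [this]
    by_cases h : n + 1 - m = 3
    · rw [h]
      exact mul_eq_zero_of_right _ h1
    · rw [evalList_of_length_ne (by simpa using h), mul_zero]
  · have := evalList_wedgePow hC (p := [E 1]) (by simp [cO_mono_E]) m n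
    rw [List.singleton_append, List.singleton_append] at this
    rw [this]
    by_cases h : n - m = 2
    · rw [h]
      exact mul_eq_zero_of_right _ h2
    · rw [evalList_of_length_ne (by simpa using h), mul_zero]

/-- The second functional takes the value `2 m! + (m + 1)! / 2 = m! (m + 5) / 2` on `b³ ∧ C(1)^m`
and 0 on `a³ ∧ C(1)^m`; the first takes the values 0 and `m!`. -/
theorem classVanishes_sub_iff {m : ℕ} (C : (Fin (3 + m) → B1 K) → K) (s t : K) :
    ClassVanishes (C - (s • wedgePow (a3 K) (cO K 0) m + t • wedgePow (b3 K) (cO K 0) m)) ↔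
      evalList (3 + m) (E 0 :: E 1 :: E 2 :: ones m) C = s * m.factorial ∧
      2 * evalList (3 + m) (E 0 :: E 1 :: O 1 :: ones m) C -
        evalList (3 + m) (E 0 :: E 2 :: ones (m + 1)) C = t * (m.factorial * ((m + 5) / 2)) := by
  obtain ⟨-, -, a1, a2, a4⟩ := a3_values (K := K)
  obtain ⟨-, -, b1, b2, b4⟩ := b3_values (K := K)
  have e1 : ∀ x ∈ [E 0, E 1, E 2], cO K 0 (mono x) = 0 := by simp [cO_mono_E]
  have e2 : ∀ x ∈ [E 0, E 1, O 1], cO K 0 (mono x) = 0 := by simp [cO_mono_E, cO_mono_O]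
  have e3 : ∀ x ∈ [E 0, E 2], cO K 0 (mono x) = 0 := by simp [cO_mono_E]
  rw [classVanishes_iff]
  simp only [map_sub, map_add, map_smul, smul_eq_mul, evalList_wedgePow_three a3_mem _ _ _ e1,
    evalList_wedgePow_three a3_mem _ _ _ e2, evalList_wedgePow_two a3_mem _ _ e3,
    evalList_wedgePow_three b3_mem _ _ _ e1, evalList_wedgePow_three b3_mem _ _ _ e2,
    evalList_wedgePow_two b3_mem _ _ e3, a1, a2, a4, b1, b2, b4, Nat.factorial_succ]
  push_cast
  constructor
  · rintro ⟨h1, h2⟩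
    exact ⟨by linear_combination h1, by linear_combination h2⟩
  · rintro ⟨h1, h2⟩
    exact ⟨by linear_combination h1, by linear_combination h2⟩

theorem cohomologyClass_eq_zero_iff {k : ℕ} (hk : k ≠ 0) {C : (Fin k → B1 K) → K}
    (hC : C ∈ cocycles K k) : cohomologyClass K C hC = 0 ↔ ClassVanishes C :=
  (cohomologyClass_eq_zero_iff_mem hC).trans (mem_coboundaries_iff hk hC)

theorem subsingleton_cohomology {k : ℕ} (h0 : k ≠ 0) (h3 : k < 3) :
    Subsingleton (Cohomology K k) := by
  refine subsingleton_of_forall_eq 0 fun x => ?_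
  obtain ⟨⟨C, hC⟩, rfl⟩ := Submodule.Quotient.mk_surjective _ x
  refine (cohomologyClass_eq_zero_iff h0 hC).2 fun n => ?_
  rw [evalList_of_length_ne (by simp; omega), evalList_of_length_ne (by simp; omega),
    evalList_of_length_ne (by simp; omega)]
  simp

end CharZero

end Buttin

/-! ### The cohomology of `B(1)` -/

theorem mainTheorem2 (K : Type*) [Field K] [CharZero K] :
    (Buttin.IsOdd (1 : Buttin.B1 K) ∧
      ∀ f : Buttin.B1 K, Buttin.bracket f 1 = 0 ∧ Buttin.bracket 1 f = 0) ∧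
    (∃ h1 : (Buttin.unitCochain : (Fin 0 → Buttin.B1 K) → K) ∈ Buttin.cocycles K 0,
      Buttin.cohomologyClass K Buttin.unitCochain h1 ≠ 0 ∧
      Submodule.span K {Buttin.cohomologyClass K Buttin.unitCochain h1} = ⊤) ∧
    Subsingleton (Buttin.Cohomology K 1) ∧
    Subsingleton (Buttin.Cohomology K 2) ∧
    ∀ m : ℕ,
      ∃ (ha : Buttin.wedgePow (Buttin.a3 K) (Buttin.cO K 0) m ∈ Buttin.cocycles K (3 + m))
        (hb : Buttin.wedgePow (Buttin.b3 K) (Buttin.cO K 0) m ∈ Buttin.cocycles K (3 + m)),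
        LinearIndependent K ![Buttin.cohomologyClass K _ ha, Buttin.cohomologyClass K _ hb] ∧
        Submodule.span K {Buttin.cohomologyClass K _ ha, Buttin.cohomologyClass K _ hb} = ⊤ := by
  refine ⟨⟨by simp [Buttin.IsOdd], fun f => ⟨?_, ?_⟩⟩, ⟨?_, ?_, ?_⟩,
    Buttin.subsingleton_cohomology (by norm_num) (by norm_num),
    Buttin.subsingleton_cohomology (by norm_num) (by norm_num), fun m => ?_⟩
  · ext1 <;> simp [Buttin.bracket_fst, Buttin.bracket_snd]
  · ext1 <;> simp [Buttin.bracket_fst, Buttin.bracket_snd]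
  · exact Submodule.mem_inf.2 ⟨Buttin.unitCochain_mem,
      LinearMap.mem_ker.2 (Buttin.differential_zero _)⟩
  · intro h
    have h1 := congrFun ((Submodule.mem_bot K).1
      ((Buttin.cohomologyClass_eq_zero_iff_mem _).1 h)) Fin.elim0
    simp [Buttin.unitCochain] at h1
  · rw [eq_top_iff]
    rintro x -
    obtain ⟨⟨C, hC⟩, rfl⟩ := Submodule.Quotient.mk_surjective _ x
    refine Submodule.mem_span_singleton.2 ⟨C Fin.elim0,
      congrArg Submodule.Quotient.mk (Subtype.ext (funext fun a => ?_))⟩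
    simp [Buttin.unitCochain, Subsingleton.elim a Fin.elim0]
  · obtain ⟨a1, a2, -⟩ := Buttin.a3_values (K := K)
    obtain ⟨b1, b2, -⟩ := Buttin.b3_values (K := K)
    have ha := Buttin.wedgePow_mem_cocycles Buttin.a3_mem Buttin.a3_weightZero a1 a2 m
    have hb := Buttin.wedgePow_mem_cocycles Buttin.b3_mem Buttin.b3_weightZero b1 b2 m
    have hk : 3 + m ≠ 0 := by omega
    have h0 : (m.factorial : K) ≠ 0 := Nat.cast_ne_zero.2 m.factorial_ne_zero
    have h5 : ((m : K) + 5) / 2 ≠ 0 :=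
      div_ne_zero (by exact_mod_cast (by omega : m + 5 ≠ 0)) two_ne_zero
    -- Turns any relation between classes into the two scalar equations of `classVanishes_sub_iff`;
    -- independence is the case `C = 0`, and spanning follows by solving for the coefficients.
    have key : ∀ (C : (Fin (3 + m) → Buttin.B1 K) → K) (hC : C ∈ Buttin.cocycles K (3 + m))
        (s t : K), Buttin.cohomologyClass K C hC = s • Buttin.cohomologyClass K _ ha +
          t • Buttin.cohomologyClass K _ hb ↔ Buttin.ClassVanishes
            (C - (s • Buttin.wedgePow (Buttin.a3 K) (Buttin.cO K 0) m +
              t • Buttin.wedgePow (Buttin.b3 K) (Buttin.cO K 0) m)) := by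
      intro C hC s t
      rw [← Buttin.cohomologyClass_eq_zero_iff hk (Submodule.sub_mem _ hC (Submodule.add_mem _
        (Submodule.smul_mem _ s ha) (Submodule.smul_mem _ t hb))), ← sub_eq_zero]
      rfl
    refine ⟨ha, hb, LinearIndependent.pair_iff.2 fun s t hst => ?_, ?_⟩
    · have h := (key 0 (Submodule.zero_mem _) s t).1 (hst ▸ rfl)
      rw [Buttin.classVanishes_sub_iff] at h
      simp only [map_zero, mul_zero, sub_zero] at h
      exact ⟨(mul_eq_zero.1 h.1.symm).resolve_right h0,
        (mul_eq_zero.1 h.2.symm).resolve_right (mul_ne_zero h0 h5)⟩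
    · rw [eq_top_iff]
      rintro x -
      obtain ⟨⟨C, hC⟩, rfl⟩ := Submodule.Quotient.mk_surjective _ x
      -- The coefficients are the two functionals at `C` divided by `m!` and by `m! (m + 5) / 2`.
      refine Submodule.mem_span_pair.2 ⟨_, _, ((key C hC _ _).2
        ((Buttin.classVanishes_sub_iff C _ _).2
          ⟨(div_mul_cancel₀ _ h0).symm, (div_mul_cancel₀ _ (mul_ne_zero h0 h5)).symm⟩)).symm⟩
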